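/- Let $K$ be a field of characteristic zero and $n\ge 0$. Let $S=K[p_1,\dots,p_n,q_1,\dots,q_n]=\bigoplus_{k\ge 0}S^k$, graded by total degree, and let $m$ be its commutative product. Define $\wp$ on $S\otimes S$ by $$\wp(F\otimes G)=\sum_{i=1}^n\Big(\frac{\partial F}{\partial p_i}\otimes\frac{\partial G}{\partial q_i}-\frac{\partial F}{\partial q_i}\otimes\frac{\partial G}{\partial p_i}\Big),$$ and the Moyal product by $$F\star G=\sum_{k\ge 0}\frac{1}{2^k k!}\,m\big(\wp^k(F\otimes G)\big).$$ Write $W$ for $S$ with the product $\star$. Put $W_{\bar 0}=\bigoplus_k S^{2k}$ and $W_{\bar 1}=\bigoplus_k S^{2k+1}$. Let $[\cdot,\cdot]$ be the bilinear super bracket with $[F,G]=F\star G-(-1)^{fg}G\star F$ for $F\in W_f$, $G\in W_g$ ($f,g\in\mathbb Z/2$). Let $[W,W]$ be the linear span of all brackets. Put $\mathrm{Str}(F)=F(0)$ and $\kappa(F,G)=\mathrm{Str}(F\star G)$. A bilinear form $B$ on $W$ is called ad-invariant if $$B([F,G],H)+(-1)^{fg}B(G,[F,H])=0\qquad\text{for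 all } F\in W_f,\ G\in W_g,\ H\in W.$$ **Theorem.** 0. $W$ is the Weyl algebra: there is a $K$-linear bijection from the algebra with generators $p_i,q_i$ ($1\le i\le n$) and relations $p_iq_j-q_jp_i=\delta_{ij}$, $p_ip_j=p_jp_i$, $q_iq_j=q_jq_i$ onto $S$ which sends $1$ to $1$, each generator to the variable of the same name, and products to $\star$-products. 1. $\mathrm{Str}$ is a supertrace: it vanishes on $W_{\bar 1}$, and $\mathrm{Str}([F,G])=0$ for all $F,G\in W$. Moreover $\ker(\mathrm{Str})=[W,W]$. 2. $\kappa$ is supersymmetric, that is, $\kappa(G,F)=(-1)^{fg}\kappa(F,G)$ for $F\in W_f$, $G\in W_g$. It is also ad-invariant and non-degenerate. 3. $\kappa(S^\ell,S^m)=\{0\}$ for $\ell\ne m$, and the restriction of $\kappa$ to each $S^\ell$ is non-degenerate. 4. If $\kappa'$ is any ad-invariant bilinear form on $W$, there is $\alpha\in K$ with $\kappa'(F,G)=\alpha\,\kappa(F,G)$ for all $F,G\in[W,W]$. -/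

import Mathlib

open scoped TensorProduct

noncomputable section

namespace Moyal

variable (K : Type*) [Field K] (n : ℕ)

/-- The commutative polynomial algebra `S = K[p₁, …, pₙ, q₁, …, qₙ]`. The variable `Sum.inl i`
is `pᵢ` and `Sum.inr i` is `qᵢ`. -/
abbrev Poly : Type _ := MvPolynomial (Fin n ⊕ Fin n) K

/-- The relations of the Weyl algebra: `pᵢ qⱼ - qⱼ pᵢ = δᵢⱼ`, the `pᵢ` commute, the `qᵢ` commute. -/
inductive WeylRel : FreeAlgebra K (Fin n ⊕ Fin n) → FreeAlgebra K (Fin n ⊕ Fin n) → Prop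
  | pq (i j : Fin n) :
      WeylRel
        (FreeAlgebra.ι K (Sum.inl i) * FreeAlgebra.ι K (Sum.inr j)
          - FreeAlgebra.ι K (Sum.inr j) * FreeAlgebra.ι K (Sum.inl i))
        (if i = j then 1 else 0)
  | pp (i j : Fin n) :
      WeylRel
        (FreeAlgebra.ι K (Sum.inl i) * FreeAlgebra.ι K (Sum.inl j)
          - FreeAlgebra.ι K (Sum.inl j) * FreeAlgebra.ι K (Sum.inl i))
        0
  | qq (i j : Fin n) :
      WeylRel
        (FreeAlgebra.ι K (Sum.inr i) * FreeAlgebra.ι K (Sum.inr j)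
          - FreeAlgebra.ι K (Sum.inr j) * FreeAlgebra.ι K (Sum.inr i))
        0

/-- The Weyl algebra `W(n)`, by generators and relations. -/
abbrev WeylAlgebra : Type _ := RingQuot (WeylRel K n)

/-- The class in the Weyl algebra of a generator. -/
def weylGen (s : Fin n ⊕ Fin n) : WeylAlgebra K n :=
  RingQuot.mkAlgHom K (WeylRel K n) (FreeAlgebra.ι K s)

/-- The partial derivative with respect to a variable, as a linear map. -/
def pd (s : Fin n ⊕ Fin n) : Poly K n →ₗ[K] Poly K n :=
  (MvPolynomial.pderiv s : Derivation K (Poly K n) (Poly K n)).toLinearMap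

/-- The operator
`℘(F ⊗ G) = ∑ᵢ (∂F/∂pᵢ ⊗ ∂G/∂qᵢ - ∂F/∂qᵢ ⊗ ∂G/∂pᵢ)` on `S ⊗ S`. -/
def wp : Module.End K (Poly K n ⊗[K] Poly K n) :=
  ∑ i : Fin n,
    (TensorProduct.map (pd K n (Sum.inl i)) (pd K n (Sum.inr i))
      - TensorProduct.map (pd K n (Sum.inr i)) (pd K n (Sum.inl i)))

/-- `C_k(F, G) = (1 / (2^k k!)) m(℘^k(F ⊗ G))`, where `m` is the commutative product of `S`. -/
def C (k : ℕ) : Poly K n →ₗ[K] Poly K n →ₗ[K] Poly K n :=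
  (TensorProduct.mk K (Poly K n) (Poly K n)).compr₂
    (((2 : K) ^ k * (Nat.factorial k : K))⁻¹ • (LinearMap.mul' K (Poly K n) ∘ₗ (wp K n) ^ k))

/-- The span of the tensors `F ⊗ G` with `F` homogeneous of degree less than `d`. -/
def lowDeg (d : ℕ) : Submodule K (Poly K n ⊗[K] Poly K n) :=
  Submodule.span K {x | ∃ F G : Poly K n, ∃ j < d, F.IsHomogeneous j ∧ x = F ⊗ₜ[K] G}

variable {K n}

theorem pd_tmul_mem_lowDeg (s : Fin n ⊕ Fin n) (d j : ℕ) (hj : j < d + 1) (F G : Poly K n)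
    (hF : F.IsHomogeneous j) : (pd K n s F) ⊗ₜ[K] G ∈ lowDeg K n d := by
  rcases j with _ | j
  · rw [← MvPolynomial.totalDegree_zero_iff_isHomogeneous,
      MvPolynomial.totalDegree_eq_zero_iff_eq_C] at hF
    rw [hF]
    simp [pd]
  · refine Submodule.subset_span ⟨_, _, j, by omega, ?_, rfl⟩
    simpa [pd] using hF.pderiv (i := s)

theorem wp_mem_lowDeg (d : ℕ) (x : Poly K n ⊗[K] Poly K n) (hx : x ∈ lowDeg K n (d + 1)) :
    wp K n x ∈ lowDeg K n d := by
  refine (Submodule.span_le (p := (lowDeg K n d).comap (wp K n))).2 ?_ hx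
  rintro _ ⟨F, G, j, hj, hF, rfl⟩
  simp only [wp, Submodule.comap_coe, Set.mem_preimage, SetLike.mem_coe, LinearMap.sum_apply,
    LinearMap.sub_apply, TensorProduct.map_tmul]
  exact Submodule.sum_mem _ fun i _ => Submodule.sub_mem _
    (pd_tmul_mem_lowDeg _ d j hj F _ hF) (pd_tmul_mem_lowDeg _ d j hj F _ hF)

theorem wp_pow_eq_zero (d : ℕ) (x : Poly K n ⊗[K] Poly K n) (hx : x ∈ lowDeg K n d) :
    ((wp K n) ^ d) x = 0 := by
  induction d generalizing x with
  | zero =>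
    have h : lowDeg K n 0 = ⊥ := by simp [lowDeg]
    simpa [h] using hx
  | succ d ih =>
    rw [pow_succ, Module.End.mul_apply]
    exact ih _ (wp_mem_lowDeg d x hx)

theorem wp_pow_tmul_eq_zero (F G : Poly K n) (k : ℕ) (hk : F.totalDegree < k) :
    ((wp K n) ^ k) (F ⊗ₜ[K] G) = 0 := by
  refine wp_pow_eq_zero k _ ?_
  rw [← MvPolynomial.sum_homogeneousComponent F, TensorProduct.sum_tmul]
  refine Submodule.sum_mem _ fun j hj => Submodule.subset_span ⟨_, _, j, ?_,
    MvPolynomial.homogeneousComponent_isHomogeneous j F, rfl⟩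
  have := Finset.mem_range.1 hj
  omega

/-- Only finitely many terms of the series defining the star product are nonzero. -/
theorem C_support_finite (F G : Poly K n) :
    (Function.support fun k => C K n k F G).Finite := by
  refine (Set.finite_Iic F.totalDegree).subset fun k hk => ?_
  by_contra h
  refine hk ?_
  simp [C, wp_pow_tmul_eq_zero F G k (by simpa using h)]

variable (K n)

/-- The Moyal star product `F ⋆ G = ∑_{k ≥ 0} C_k(F, G)` (with parameter `t = 1`), a bilinear map;
the sum is locally finite by `C_support_finite`. -/
def star : Poly K n →ₗ[K] Poly K n →ₗ[K] Poly K n :=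
  LinearMap.mk₂ K (fun F G => ∑ᶠ k : ℕ, C K n k F G)
    (fun F F' G => by
      simp only [map_add, LinearMap.add_apply]
      exact finsum_add_distrib (C_support_finite F G) (C_support_finite F' G))
    (fun c F G => by
      simp only [map_smul, LinearMap.smul_apply]
      exact (smul_finsum c _).symm)
    (fun F G G' => by
      simp only [map_add]
      exact finsum_add_distrib (C_support_finite F G) (C_support_finite F G'))
    (fun c F G => by
      simp only [map_smul]
      exact (smul_finsum c _).symm)

/-- The homogeneous component `S^k` of polynomials homogeneous of degree `k`. -/
abbrev homog (k : ℕ) : Submodule K (Poly K n) :=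
  MvPolynomial.homogeneousSubmodule (Fin n ⊕ Fin n) K k

/-- The parity component `W_i`, `i ∈ ℤ/2`: polynomials all of whose monomials have total degree
congruent to `i` modulo `2`, that is, the sum of the `S^k` with `k ≡ i`. -/
abbrev parity (i : ZMod 2) : Submodule K (Poly K n) :=
  MvPolynomial.weightedHomogeneousSubmodule K (fun _ : Fin n ⊕ Fin n => (1 : ZMod 2)) i

/-- The projection of `W` onto `W_i`. -/
abbrev parityProj (i : ZMod 2) : Poly K n →ₗ[K] Poly K n :=
  MvPolynomial.weightedHomogeneousComponent (fun _ : Fin n ⊕ Fin n => (1 : ZMod 2)) i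

/-- The sign `(-1)^{ij}` for `i, j ∈ ℤ/2`. -/
def sign (i j : ZMod 2) : K := (-1) ^ (i * j).val

/-- The super bracket on `W`: the bilinear map with
`[F, G] = F ⋆ G - (-1)^{fg} G ⋆ F` for `F ∈ W_f`, `G ∈ W_g`. -/
def bracket : Poly K n →ₗ[K] Poly K n →ₗ[K] Poly K n :=
  ∑ f : ZMod 2, ∑ g : ZMod 2,
    ((star K n).compl₁₂ (parityProj K n f) (parityProj K n g)
      - sign K f g • (star K n).flip.compl₁₂ (parityProj K n f) (parityProj K n g))

/-- The subspace `[W, W]` spanned by all super brackets. -/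
def derived : Submodule K (Poly K n) :=
  Submodule.span K {x | ∃ F G : Poly K n, x = bracket K n F G}

/-- The supertrace: evaluation at `0`. -/
def Str : Poly K n →ₗ[K] K :=
  (MvPolynomial.aeval (fun _ : Fin n ⊕ Fin n => (0 : K))).toLinearMap

/-- The bilinear form `κ(F, G) = Str(F ⋆ G)`. -/
def kappa : LinearMap.BilinForm K (Poly K n) := (star K n).compr₂ (Str K n)

variable {K n}

/-- `B(G, F) = (-1)^{fg} B(F, G)` for `F ∈ W_f`, `G ∈ W_g`. -/
def IsSupersymmetric (B : LinearMap.BilinForm K (Poly K n)) : Prop :=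
  ∀ f g : ZMod 2, ∀ F ∈ parity K n f, ∀ G ∈ parity K n g, B G F = sign K f g * B F G

/-- Invariance under the adjoint action `ad(F)(G) = [F, G]`:
`B(ad(F)(G), H) + (-1)^{fg} B(G, ad(F)(H)) = 0` for `F ∈ W_f`, `G ∈ W_g` and every `H`. -/
def IsAdInvariant (B : LinearMap.BilinForm K (Poly K n)) : Prop :=
  ∀ f g : ZMod 2, ∀ F ∈ parity K n f, ∀ G ∈ parity K n g, ∀ H : Poly K n,
    B (bracket K n F G) H + sign K f g * B G (bracket K n F H) = 0

end Moyal

end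

/-!
The proof reduces everything to the variables `xₛ`, that is, the `pᵢ` and `qᵢ`. Write `Dₛ` for the
Hamiltonian derivation `{xₛ, ·}` (`ham`). Since the commutator of `℘` with `xₜ ⊗ 1` is `1 ⊗ Dₜ`, one
gets `(xₛ F) ⋆ G = xₛ (F ⋆ G) + ½ F ⋆ Dₛ G` and the mirror image of it (`star_X_mul`,
`star_mul_X`). Hence `xₛ ⋆ G = (xₛ + ½ Dₛ) G`, `G ⋆ xₛ = (xₛ - ½ Dₛ) G`, and left star
multiplication by `xₛ` passes through star products (`starLeft_star`). Every homogeneous polynomial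
of positive degree has the form `∑ xₛ Gₛ` by Euler's identity, so most claims follow by induction on
the degree.

The operators `xₛ + ½ Dₛ` satisfy the Weyl relations. Acting on `1` gives a linear map
from the Weyl algebra to `S` that takes products to star products (`symbol_mul`). It is onto because
`Dₛ` lowers the degree. It is injective because an element of the kernel commutes, by induction on
the Bernstein filtration, with all generators, while the noncommutative Euler operator, a
combination of such commutators, multiplies by the degree modulo lower terms
(`eq_zero_of_commutator_stable`). Associativity of `⋆` is a consequence.

For `κ` the recursion reads `κ(xₛ F, G) = ½ κ(F, Dₛ G)` and `κ(F, xₛ G) = -½ κ(Dₛ F, G)`. This gives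
orthogonality and supersymmetry by induction, and shows that the radical is stable under all
derivatives, hence is zero as it contains no constant. Invariance is associativity plus
supersymmetry. The bracket with `xₛ` is `Dₛ` on even and `2 xₛ` on odd polynomials, so
all polynomials without constant term lie in `[W, W]`.

For uniqueness, invariance of a form `B` under the `xₛ` gives `B(xₜ Dₛ G, H) = -B(G, xₛ Dₜ H)` for
odd `G`, `H`. Hence `B` is a multiple of the symplectic form on linear polynomials, so a multiple of
`κ` may be subtracted to make it zero there. Summing the relation over conjugate
variables makes the Euler operator self-adjoint, so that different odd degrees are orthogonal; a
similar computation makes even and odd orthogonal. Invariance under the cubes `xₛ³` then carries the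
vanishing of `B` from degree `d` to degree `d + 2` (`X_mul_X_self_mul_eq_zero`), and even degrees
reduce to odd ones.
-/

noncomputable section

namespace Moyal

open MvPolynomial

variable {K : Type*} [Field K] {n : ℕ}

/-! ### Hamiltonian derivations -/

variable (K n) in
/-- The Hamiltonian derivation `{xₛ, ·}` of the variable `xₛ`, for the Poisson bracket with
`{pᵢ, qᵢ} = 1`: it is `∂/∂qᵢ` for `pᵢ` and `-∂/∂pᵢ` for `qᵢ`. -/
def ham : Fin n ⊕ Fin n → Poly K n →ₗ[K] Poly K n
  | Sum.inl i => pd K n (Sum.inr i)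
  | Sum.inr i => -pd K n (Sum.inl i)

variable (K) in
/-- The matrix `ωₛₜ = {xₛ, xₜ}` of the symplectic form in the variables. -/
def symp : Fin n ⊕ Fin n → Fin n ⊕ Fin n → K
  | Sum.inl i, Sum.inr j => if i = j then 1 else 0
  | Sum.inr i, Sum.inl j => if i = j then -1 else 0
  | _, _ => 0

theorem symp_swap (s t : Fin n ⊕ Fin n) : symp K t s = -symp K s t := by
  rcases s with i | i <;> rcases t with j | j <;> simp [symp, eq_comm] <;>
    split_ifs <;> simp

theorem pd_mul (s : Fin n ⊕ Fin n) (F G : Poly K n) :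
    pd K n s (F * G) = pd K n s F * G + F * pd K n s G := by
  simp [pd]; ring

theorem ham_mul (s : Fin n ⊕ Fin n) (F G : Poly K n) :
    ham K n s (F * G) = ham K n s F * G + F * ham K n s G := by
  rcases s with i | i
  · exact pd_mul _ _ _
  · simp only [ham, LinearMap.neg_apply, pd_mul]; ring

theorem pd_X (s t : Fin n ⊕ Fin n) : pd K n s (X t) = if s = t then 1 else 0 := by
  classical
  simp [pd, pderiv_X, Pi.single_apply, eq_comm]

theorem ham_X (s t : Fin n ⊕ Fin n) :
    ham K n s (X t) = MvPolynomial.C (symp K s t) := by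
  rcases s with i | i <;> rcases t with j | j <;> simp [ham, pd_X, symp, apply_ite]

theorem ham_X_mul (s t : Fin n ⊕ Fin n) (F : Poly K n) :
    ham K n s (X t * F) = symp K s t • F + X t * ham K n s F := by
  rw [ham_mul, ham_X, MvPolynomial.C_mul']

theorem ham_X_self_mul (s : Fin n ⊕ Fin n) (F : Poly K n) :
    ham K n s (X s * F) = X s * ham K n s F := by
  have : symp K s s = 0 := by rcases s with i | i <;> rfl
  rw [ham_X_mul, this, zero_smul, zero_add]

theorem ham_C (s : Fin n ⊕ Fin n) (c : K) : ham K n s (MvPolynomial.C c) = 0 := by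
  rcases s with i | i <;> simp [ham, pd]

theorem ham_one (s : Fin n ⊕ Fin n) : ham K n s 1 = 0 := by
  simpa using ham_C s (1 : K)

theorem pd_comm (s t : Fin n ⊕ Fin n) (F : Poly K n) :
    pd K n s (pd K n t F) = pd K n t (pd K n s F) := by
  have h : ⁅(pderiv s : Derivation K (Poly K n) (Poly K n)),
      (pderiv t : Derivation K (Poly K n) (Poly K n))⁆ = 0 := by
    refine MvPolynomial.derivation_ext fun i => ?_
    classical
    simp [Derivation.commutator_apply, pderiv_X, Pi.single_apply, apply_ite]
  have := congrArg (fun D => D F) h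
  rw [Derivation.commutator_apply] at this
  exact sub_eq_zero.1 this

theorem ham_comm (s t : Fin n ⊕ Fin n) (F : Poly K n) :
    ham K n s (ham K n t F) = ham K n t (ham K n s F) := by
  rcases s with i | i <;> rcases t with j | j <;>
    simp [ham, pd_comm (Sum.inl i), pd_comm (Sum.inr i)]

theorem pd_ham_comm (s t : Fin n ⊕ Fin n) (F : Poly K n) :
    pd K n s (ham K n t F) = ham K n t (pd K n s F) := by
  rcases t with j | j <;> simp [ham, pd_comm s]

/-- Up to sign, partial derivatives are Hamiltonian derivations of variables. -/
theorem exists_pd_eq_ham (s : Fin n ⊕ Fin n) :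
    ∃ (c : K) (t : Fin n ⊕ Fin n), c * symp K t s = 1 ∧ ∀ F, pd K n s F = c • ham K n t F := by
  rcases s with i | i
  · exact ⟨-1, Sum.inr i, by simp [symp], fun F => by simp [ham]⟩
  · exact ⟨1, Sum.inl i, by simp [symp], fun F => by simp [ham]⟩

theorem ham_eq_smul_pd (s : Fin n ⊕ Fin n) :
    ∃ (c : K) (t : Fin n ⊕ Fin n), c ≠ 0 ∧ ∀ F, ham K n s F = c • pd K n t F := by
  rcases s with i | i
  · exact ⟨1, Sum.inr i, by simp, fun F => by simp [ham]⟩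
  · exact ⟨-1, Sum.inl i, by simp, fun F => by simp [ham]⟩

/-! ### Homogeneous polynomials and parity -/

theorem isHomogeneous_pd {k : ℕ} {F : Poly K n} (hF : F.IsHomogeneous k) (s : Fin n ⊕ Fin n) :
    (pd K n s F).IsHomogeneous (k - 1) := hF.pderiv

theorem isHomogeneous_ham {k : ℕ} {F : Poly K n} (hF : F.IsHomogeneous k) (s : Fin n ⊕ Fin n) :
    (ham K n s F).IsHomogeneous (k - 1) := by
  rcases s with i | i
  · exact isHomogeneous_pd hF _
  · exact (isHomogeneous_pd hF _).neg

theorem isHomogeneous_X_mul {k : ℕ} {F : Poly K n} (hF : F.IsHomogeneous k) (s : Fin n ⊕ Fin n) :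
    (X s * F : Poly K n).IsHomogeneous (k + 1) := by
  rw [add_comm]; exact (isHomogeneous_X K s).mul hF

theorem isHomogeneous_smul {k : ℕ} {F : Poly K n} (hF : F.IsHomogeneous k) (c : K) :
    (c • F).IsHomogeneous k := (homog K n k).smul_mem c hF

theorem sum_X_mul_pd {k : ℕ} {F : Poly K n} (hF : F.IsHomogeneous k) :
    ∑ s, X s * pd K n s F = (k : K) • F := by
  have := hF.sum_X_mul_pderiv
  simpa [pd, Nat.cast_smul_eq_nsmul] using this

/-- By Euler's identity, a homogeneous polynomial of positive degree is a combination of the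
variables with homogeneous coefficients. -/
theorem exists_eq_sum_X_mul [CharZero K] {k : ℕ} {F : Poly K n} (hF : F.IsHomogeneous (k + 1)) :
    ∃ G : Fin n ⊕ Fin n → Poly K n, (∀ s, (G s).IsHomogeneous k) ∧ F = ∑ s, X s * G s := by
  refine ⟨fun s => ((k + 1 : ℕ) : K)⁻¹ • pd K n s F,
    fun s => isHomogeneous_smul (isHomogeneous_pd hF s) _, ?_⟩
  have h : ((k + 1 : ℕ) : K) ≠ 0 := Nat.cast_ne_zero.2 k.succ_ne_zero
  simp only [mul_smul_comm]
  rw [← Finset.smul_sum, sum_X_mul_pd hF, smul_smul, inv_mul_cancel₀ h, one_smul]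

/-- Hamiltonian derivations of variables are surjective, in characteristic zero. -/
theorem exists_ham_eq [CharZero K] {k : ℕ} {F : Poly K n} (hF : F.IsHomogeneous k)
    (s : Fin n ⊕ Fin n) : ∃ G : Poly K n, G.IsHomogeneous (k + 1) ∧ ham K n s G = F := by
  obtain ⟨c, t, hc, h⟩ := ham_eq_smul_pd (K := K) s
  have key : ∃ G : Poly K n, G.IsHomogeneous (k + 1) ∧ pd K n t G = F := by
    -- Integrate each monomial.
    refine ⟨∑ m ∈ F.support, monomial (m + Finsupp.single t 1) (F.coeff m / ((m t + 1 : ℕ) : K)),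
      IsHomogeneous.sum _ _ _ fun m hm => isHomogeneous_monomial _ ?_, ?_⟩
    · have : m.degree = k := by
        by_contra h'
        exact mem_support_iff.1 hm (hF.coeff_eq_zero h')
      simp [map_add, this]
    · conv_rhs => rw [F.as_sum]
      rw [map_sum]
      refine Finset.sum_congr rfl fun m _ => ?_
      have h : ((m t + 1 : ℕ) : K) ≠ 0 := Nat.cast_ne_zero.2 (m t).succ_ne_zero
      simp only [pd, Derivation.coeFn_coe, pderiv_monomial]
      simp only [add_tsub_cancel_right, Finsupp.add_apply, Finsupp.single_eq_same]
      rw [div_mul_cancel₀ _ h]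
  obtain ⟨G, hG, hGF⟩ := key
  refine ⟨c⁻¹ • G, isHomogeneous_smul hG _, ?_⟩
  rw [map_smul, h, hGF, smul_smul, inv_mul_cancel₀ hc, one_smul]

theorem mem_parity {k : ℕ} {F : Poly K n} (hF : F.IsHomogeneous k) :
    F ∈ parity K n (k : ZMod 2) := by
  intro d hd
  have := hF hd
  rw [Finsupp.weight_apply] at this ⊢
  rw [← this]
  simp [Finsupp.sum]

/-- A property of polynomials that is preserved by sums holds on `W_f` as soon as it holds for
homogeneous polynomials of degree congruent to `f`. -/
theorem parity_induction {P : Poly K n → Prop} (h0 : P 0) (hadd : ∀ F G, P F → P G → P (F + G))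
    {f : ZMod 2} (hP : ∀ (k : ℕ) (F : Poly K n), (k : ZMod 2) = f → F.IsHomogeneous k → P F)
    {F : Poly K n} (hF : F ∈ parity K n f) : P F := by
  rw [F.as_sum]
  refine Finset.sum_induction _ P hadd h0 fun m hm => ?_
  refine hP m.degree _ ?_ (isHomogeneous_monomial _ rfl)
  have := hF (mem_support_iff.1 hm)
  rw [← this, Finsupp.weight_apply]
  simp [Finsupp.sum, Finsupp.degree_apply]

/-- A property of polynomials that is preserved by sums holds as soon as it holds for homogeneous
polynomials. -/
theorem homog_induction {P : Poly K n → Prop} (hadd : ∀ F G, P F → P G → P (F + G))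
    (hP : ∀ (k : ℕ) (F : Poly K n), F.IsHomogeneous k → P F) (F : Poly K n) : P F := by
  rw [F.as_sum]
  exact Finset.sum_induction _ P hadd (hP 0 0 (isHomogeneous_zero _ _ _)) fun m _ =>
    hP m.degree _ (isHomogeneous_monomial _ rfl)

theorem parity_X_mul {f : ZMod 2} {F : Poly K n} (hF : F ∈ parity K n f) (s : Fin n ⊕ Fin n) :
    (X s * F : Poly K n) ∈ parity K n (f + 1) := by
  rw [add_comm]
  exact (isWeightedHomogeneous_X K _ s).mul hF

theorem parity_ham {f : ZMod 2} {F : Poly K n} (hF : F ∈ parity K n f) (s : Fin n ⊕ Fin n) :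
    ham K n s F ∈ parity K n (f + 1) := by
  refine parity_induction (P := fun F => ham K n s F ∈ parity K n (f + 1)) ?_ ?_ ?_ hF
  · simp
  · intro F G hF hG
    rw [map_add]; exact Submodule.add_mem _ hF hG
  · rintro (_ | k) F hk hF
    · have := totalDegree_eq_zero_iff_eq_C.1 ((totalDegree_zero_iff_isHomogeneous _).2 hF)
      rw [this, ham_C]; exact Submodule.zero_mem _
    · convert mem_parity (isHomogeneous_ham hF s) using 2
      rw [← hk]
      push_cast
      rw [add_assoc, CharTwo.add_self_eq_zero, add_zero]

theorem totalDegree_pd_le (s : Fin n ⊕ Fin n) {d : ℕ} {F : Poly K n}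
    (hF : F.totalDegree ≤ d + 1) : (pd K n s F).totalDegree ≤ d := by
  refine Finset.sup_le fun m hm => ?_
  have h : m + Finsupp.single s 1 ∈ F.support := by
    rw [mem_support_iff] at hm ⊢
    intro h
    simp [pd, coeff_pderiv, h] at hm
  have := (le_totalDegree h).trans hF
  rw [Finsupp.sum_add_index' (by simp) (by simp)] at this
  simpa using this

/-- In characteristic zero a subspace of polynomials that is stable under the derivations `ham s`
and contains no nonzero constant is zero. -/
theorem eq_zero_of_ham_stable [CharZero K] (N : Submodule K (Poly K n))
    (hN : ∀ s, ∀ F ∈ N, ham K n s F ∈ N) (hC : ∀ c : K, MvPolynomial.C c ∈ N → c = 0)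
    {F : Poly K n} (hF : F ∈ N) : F = 0 := by
  have key : ∀ d : ℕ, ∀ F ∈ N, F.totalDegree ≤ d → F = 0 := by
    intro d
    induction d with
    | zero =>
      intro F hF hd
      have := (totalDegree_eq_zero_iff_eq_C (p := F)).1 (Nat.le_zero.1 hd)
      rw [this] at hF ⊢
      rw [hC _ hF, map_zero]
    | succ d ih =>
      intro F hF hd
      have h0 : ∀ s, pd K n s F = 0 := by
        intro s
        obtain ⟨c, t, -, h⟩ := exists_pd_eq_ham (K := K) s
        refine ih _ (by rw [h]; exact N.smul_mem _ (hN t F hF)) (totalDegree_pd_le s hd)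
      refine ih F hF (le_trans (Finset.sup_le fun m hm => ?_) d.zero_le)
      have hm0 : m = 0 := by
        by_contra hm0
        obtain ⟨s, hs⟩ := Finsupp.ne_iff.1 hm0
        have h1 : m - Finsupp.single s 1 + Finsupp.single s 1 = m :=
          tsub_add_cancel_of_le (Finsupp.single_le_iff.2 (Nat.one_le_iff_ne_zero.2 hs))
        have h2 := congrArg (coeff (m - Finsupp.single s 1)) (h0 s)
        simp only [pd, Derivation.coeFn_coe, coeff_pderiv, h1, coeff_zero] at h2
        exact mem_support_iff.1 hm
          ((mul_eq_zero.1 h2).resolve_right (Nat.cast_add_one_ne_zero _))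
      simp [hm0]
  exact key _ F hF le_rfl

/-! ### Multiplication by a variable and the star product -/

theorem wp_tmul (F G : Poly K n) :
    wp K n (F ⊗ₜ[K] G) = ∑ s, pd K n s F ⊗ₜ[K] ham K n s G := by
  simp [wp, ham, Fintype.sum_sum_type, TensorProduct.tmul_neg, sub_eq_add_neg,
    Finset.sum_add_distrib]

/-- The commutator of `℘` with multiplication of the first factor by `xₜ` is `1 ⊗ {xₜ, ·}`. -/
theorem wp_X_mul (t : Fin n ⊕ Fin n) :
    wp K n * TensorProduct.map (LinearMap.mulLeft K (X t)) LinearMap.id =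
      TensorProduct.map (LinearMap.mulLeft K (X t)) LinearMap.id * wp K n +
        TensorProduct.map LinearMap.id (ham K n t) := by
  refine TensorProduct.ext' fun F G => ?_
  simp only [Module.End.mul_apply, LinearMap.add_apply, TensorProduct.map_tmul, wp_tmul, map_sum,
    LinearMap.mulLeft_apply, LinearMap.id_apply, pd_mul, pd_X, TensorProduct.add_tmul,
    Finset.sum_add_distrib]
  rw [add_comm]
  congr 1
  simp [TensorProduct.ite_tmul]

theorem wp_comm_ham (t : Fin n ⊕ Fin n) :
    Commute (wp K n) (TensorProduct.map LinearMap.id (ham K n t)) := by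
  refine TensorProduct.ext' fun F G => ?_
  simp [Module.End.mul_apply, TensorProduct.map_tmul, wp_tmul, ham_comm t]

theorem wp_comm_ham_left (t : Fin n ⊕ Fin n) :
    Commute (wp K n) (TensorProduct.map (ham K n t) LinearMap.id) := by
  refine TensorProduct.ext' fun F G => ?_
  simp [Module.End.mul_apply, TensorProduct.map_tmul, wp_tmul, pd_ham_comm]

theorem wp_pow_X_mul (t : Fin n ⊕ Fin n) (k : ℕ) :
    wp K n ^ (k + 1) * TensorProduct.map (LinearMap.mulLeft K (X t)) LinearMap.id =
      TensorProduct.map (LinearMap.mulLeft K (X t)) LinearMap.id * wp K n ^ (k + 1) +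
        ((k + 1 : ℕ) : K) • (wp K n ^ k * TensorProduct.map LinearMap.id (ham K n t)) := by
  induction k with
  | zero => simpa using wp_X_mul t
  | succ k ih =>
    rw [pow_succ', mul_assoc, ih, mul_add, ← mul_assoc, wp_X_mul, add_mul,
      ((wp_comm_ham t).symm.pow_right (k + 1)).eq, mul_smul_comm, ← mul_assoc, ← pow_succ',
      mul_assoc, ← pow_succ', add_assoc, Nat.cast_succ (k + 1), add_smul _ (1 : K), one_smul,
      add_comm (_ • _)]

theorem C_apply (k : ℕ) (F G : Poly K n) :
    C K n k F G = ((2 : K) ^ k * (Nat.factorial k : K))⁻¹ •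
      LinearMap.mul' K (Poly K n) ((wp K n ^ k) (F ⊗ₜ[K] G)) := rfl

theorem C_zero_apply (F G : Poly K n) : C K n 0 F G = F * G := by
  simp [C_apply]

theorem mul'_map_mulLeft (H : Poly K n) (z : Poly K n ⊗[K] Poly K n) :
    LinearMap.mul' K (Poly K n) (TensorProduct.map (LinearMap.mulLeft K H) LinearMap.id z) =
      H * LinearMap.mul' K (Poly K n) z := by
  induction z with
  | zero => simp
  | tmul F G => simp [mul_assoc]
  | add x y hx hy => simp only [map_add, hx, hy, mul_add]

theorem ham_mul' (t : Fin n ⊕ Fin n) (z : Poly K n ⊗[K] Poly K n) :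
    ham K n t (LinearMap.mul' K (Poly K n) z) =
      LinearMap.mul' K (Poly K n) (TensorProduct.map (ham K n t) LinearMap.id z) +
      LinearMap.mul' K (Poly K n) (TensorProduct.map LinearMap.id (ham K n t) z) := by
  induction z with
  | zero => simp
  | tmul F G => simp [ham_mul]
  | add x y hx hy => simp only [map_add, hx, hy]; abel

theorem C_succ_X_mul [CharZero K] (t : Fin n ⊕ Fin n) (k : ℕ) (F G : Poly K n) :
    C K n (k + 1) (X t * F) G =
      X t * C K n (k + 1) F G + (2 : K)⁻¹ • C K n k F (ham K n t G) := by
  have h := congrArg (fun T => LinearMap.mul' K (Poly K n) (T (F ⊗ₜ[K] G))) (wp_pow_X_mul t k)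
  simp only [Module.End.mul_apply, LinearMap.add_apply, LinearMap.smul_apply,
    TensorProduct.map_tmul, LinearMap.mulLeft_apply, LinearMap.id_apply, map_add, map_smul,
    mul'_map_mulLeft] at h
  have h1 : ((k + 1 : ℕ) : K) ≠ 0 := Nat.cast_ne_zero.2 k.succ_ne_zero
  have h2 : ((Nat.factorial k : ℕ) : K) ≠ 0 := Nat.cast_ne_zero.2 k.factorial_ne_zero
  rw [C_apply, h, smul_add, C_apply, C_apply, mul_smul_comm, smul_smul, smul_smul]
  congr 2
  rw [Nat.factorial_succ, Nat.cast_mul, pow_succ']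
  field_simp

theorem ham_C_apply (t : Fin n ⊕ Fin n) (k : ℕ) (F G : Poly K n) :
    ham K n t (C K n k F G) = C K n k (ham K n t F) G + C K n k F (ham K n t G) := by
  have h1 := LinearMap.congr_fun ((wp_comm_ham_left (K := K) t).pow_left k).eq (F ⊗ₜ[K] G)
  have h2 := LinearMap.congr_fun ((wp_comm_ham (K := K) t).pow_left k).eq (F ⊗ₜ[K] G)
  simp only [Module.End.mul_apply, TensorProduct.map_tmul, LinearMap.id_apply] at h1 h2
  simp only [C_apply, map_smul, ham_mul', h1, h2, smul_add]

theorem wp_comm_apply (z : Poly K n ⊗[K] Poly K n) :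
    wp K n (TensorProduct.comm K _ _ z) = -TensorProduct.comm K _ _ (wp K n z) := by
  induction z with
  | zero => simp
  | tmul F G => simp [wp, neg_sub]
  | add x y hx hy => simp only [map_add, hx, hy, neg_add]

/-- The bidifferential operator `C_k` is symmetric or antisymmetric according to the parity
of `k`. -/
theorem C_swap (k : ℕ) (F G : Poly K n) : C K n k G F = (-1) ^ k * C K n k F G := by
  have h : ∀ z : Poly K n ⊗[K] Poly K n, (wp K n ^ k) (TensorProduct.comm K _ _ z) =
      ((-1 : K) ^ k) • TensorProduct.comm K _ _ ((wp K n ^ k) z) := by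
    induction k with
    | zero => simp
    | succ k ih =>
      intro z
      rw [pow_succ, Module.End.mul_apply, wp_comm_apply, map_neg, ih, Module.End.mul_apply,
        pow_succ, mul_smul, neg_one_smul, smul_neg]
  have hm : ∀ z : Poly K n ⊗[K] Poly K n, LinearMap.mul' K (Poly K n)
      (TensorProduct.comm K _ _ z) = LinearMap.mul' K (Poly K n) z := by
    intro z
    induction z with
    | zero => simp
    | tmul F G => simp [mul_comm]
    | add x y hx hy => simp only [map_add, hx, hy]
  have := h (F ⊗ₜ[K] G)
  rw [TensorProduct.comm_tmul] at this
  rw [C_apply, this, map_smul, hm, smul_comm, ← C_apply, Algebra.smul_def]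
  simp

theorem C_succ_mul_X [CharZero K] (t : Fin n ⊕ Fin n) (k : ℕ) (F G : Poly K n) :
    C K n (k + 1) F (X t * G) =
      X t * C K n (k + 1) F G - (2 : K)⁻¹ • C K n k (ham K n t F) G := by
  rw [C_swap, C_succ_X_mul, C_swap _ F G, C_swap k _ G, Algebra.smul_def, Algebra.smul_def]
  have h : ((-1 : Poly K n) ^ k) * (-1) ^ k = 1 := by rw [← mul_pow]; simp
  linear_combination (X t * C K n (k + 1) F G
    - algebraMap K (Poly K n) 2⁻¹ * C K n k (ham K n t F) G) * h

theorem C_eq_zero {k : ℕ} {F : Poly K n} (hF : F.totalDegree < k) (G : Poly K n) :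
    C K n k F G = 0 := by
  rw [C_apply, wp_pow_tmul_eq_zero F G k hF, map_zero, smul_zero]

theorem star_apply (F G : Poly K n) : star K n F G = ∑ᶠ k : ℕ, C K n k F G := rfl

theorem star_eq_sum {N : ℕ} {F : Poly K n} (hF : F.totalDegree < N) (G : Poly K n) :
    star K n F G = ∑ k ∈ Finset.range N, C K n k F G := by
  rw [star_apply]
  refine finsum_eq_sum_of_support_subset _ fun k hk => ?_
  by_contra h
  simp only [Finset.coe_range, Set.mem_Iio, not_lt] at h
  exact hk (C_eq_zero (hF.trans_le h) G)

/-- Star products with a first factor divisible by a variable, in terms of star products of lower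
degree. Together with `star_mul_X` and `ham_star` this replaces further use of the series. -/
theorem star_X_mul [CharZero K] (t : Fin n ⊕ Fin n) (F G : Poly K n) :
    star K n (X t * F) G = X t * star K n F G + (2 : K)⁻¹ • star K n F (ham K n t G) := by
  -- `N` is large enough to truncate all the series below.
  set N := max (X t * F).totalDegree F.totalDegree + 1 with hN
  rw [star_eq_sum (N := N + 1) (by omega), star_eq_sum (N := N + 1) (F := F) (by omega) G,
    star_eq_sum (N := N) (F := F) (by omega), Finset.sum_range_succ', Finset.sum_range_succ' _ N,
    mul_add, Finset.mul_sum, Finset.smul_sum]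
  simp only [C_succ_X_mul, C_zero_apply, Finset.sum_add_distrib]
  ring

theorem star_mul_X [CharZero K] (t : Fin n ⊕ Fin n) (F G : Poly K n) :
    star K n F (X t * G) = X t * star K n F G - (2 : K)⁻¹ • star K n (ham K n t F) G := by
  set N := max (ham K n t F).totalDegree F.totalDegree + 1 with hN
  rw [star_eq_sum (N := N + 1) (F := F) (by omega), star_eq_sum (N := N + 1) (F := F) (by omega) G,
    star_eq_sum (N := N) (F := ham K n t F) (by omega), Finset.sum_range_succ',
    Finset.sum_range_succ' _ N, mul_add, Finset.mul_sum, Finset.smul_sum]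
  simp only [C_succ_mul_X, C_zero_apply, Finset.sum_sub_distrib]
  ring

theorem ham_star (t : Fin n ⊕ Fin n) (F G : Poly K n) :
    ham K n t (star K n F G) = star K n (ham K n t F) G + star K n F (ham K n t G) := by
  set N := max (ham K n t F).totalDegree F.totalDegree + 1 with hN
  rw [star_eq_sum (N := N) (F := F) (by omega), star_eq_sum (N := N) (F := F) (by omega),
    star_eq_sum (N := N) (F := ham K n t F) (by omega), map_sum, ← Finset.sum_add_distrib]
  exact Finset.sum_congr rfl fun k _ => ham_C_apply t k F G

theorem C_star (c : K) (G : Poly K n) : star K n (MvPolynomial.C c) G = c • G := by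
  rw [star_eq_sum (N := 1) (by simp), Finset.sum_range_one, C_zero_apply, C_mul']

theorem one_star (G : Poly K n) : star K n 1 G = G := by
  simpa using C_star (1 : K) G

theorem star_one (F : Poly K n) : star K n F 1 = F := by
  rw [star_apply, finsum_eq_single _ 0 fun k hk => ?_, C_zero_apply, mul_one]
  rw [C_swap, C_eq_zero (by simpa using Nat.pos_of_ne_zero hk), mul_zero]

variable (K n) in
/-- Left star multiplication by the variable `xₛ`, the operator `xₛ + ½ {xₛ, ·}`. -/
def starLeft (s : Fin n ⊕ Fin n) : Module.End K (Poly K n) :=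
  LinearMap.mulLeft K (X s) + (2 : K)⁻¹ • ham K n s

variable (K n) in
/-- Right star multiplication by the variable `xₛ`, the operator `xₛ - ½ {xₛ, ·}`. -/
def starRight (s : Fin n ⊕ Fin n) : Module.End K (Poly K n) :=
  LinearMap.mulLeft K (X s) - (2 : K)⁻¹ • ham K n s

theorem starLeft_apply (s : Fin n ⊕ Fin n) (F : Poly K n) :
    starLeft K n s F = X s * F + (2 : K)⁻¹ • ham K n s F := rfl

theorem starRight_apply (s : Fin n ⊕ Fin n) (F : Poly K n) :
    starRight K n s F = X s * F - (2 : K)⁻¹ • ham K n s F := rfl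

/-- The case of associativity in which the first factor is a variable, see `X_star`. -/
theorem starLeft_star [CharZero K] (s : Fin n ⊕ Fin n) (F G : Poly K n) :
    star K n (starLeft K n s F) G = starLeft K n s (star K n F G) := by
  rw [starLeft_apply, starLeft_apply, map_add, map_smul, LinearMap.add_apply,
    LinearMap.smul_apply, star_X_mul, ham_star, smul_add]
  abel

theorem star_starRight [CharZero K] (s : Fin n ⊕ Fin n) (F G : Poly K n) :
    star K n F (starRight K n s G) = starRight K n s (star K n F G) := by
  rw [starRight_apply, starRight_apply, map_sub, map_smul, star_mul_X, ham_star, smul_add]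
  abel

theorem X_star [CharZero K] (s : Fin n ⊕ Fin n) (G : Poly K n) :
    star K n (X s) G = starLeft K n s G := by
  have := starLeft_star s 1 G
  rwa [one_star, starLeft_apply, ham_one, mul_one, smul_zero, add_zero] at this

theorem star_X [CharZero K] (s : Fin n ⊕ Fin n) (F : Poly K n) :
    star K n F (X s) = starRight K n s F := by
  have := star_starRight s F 1
  rwa [star_one, starRight_apply, ham_one, mul_one, smul_zero, sub_zero] at this

/-! ### The Weyl algebra -/

theorem C_half_mul_two [CharZero K] : (MvPolynomial.C (2 : K)⁻¹ : Poly K n) * 2 = 1 := by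
  rw [← map_ofNat MvPolynomial.C 2, ← MvPolynomial.C_mul, inv_mul_cancel₀ two_ne_zero,
    MvPolynomial.C_1]

theorem starLeft_commutator [CharZero K] (s t : Fin n ⊕ Fin n) :
    starLeft K n s * starLeft K n t - starLeft K n t * starLeft K n s =
      algebraMap K _ (symp K s t) := by
  refine LinearMap.ext fun F => ?_
  simp only [LinearMap.sub_apply, Module.End.mul_apply, starLeft_apply, map_add, map_smul,
    ham_X_mul, Module.algebraMap_end_apply, ham_comm s t, symp_swap s t]
  simp only [smul_eq_C_mul, map_neg]
  linear_combination MvPolynomial.C (symp K s t) * F * C_half_mul_two (K := K) (n := n)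

theorem weylGen_commutator (s t : Fin n ⊕ Fin n) :
    weylGen K n s * weylGen K n t - weylGen K n t * weylGen K n s =
      algebraMap K _ (symp K s t) := by
  have key : ∀ {x y}, WeylRel K n x y →
      RingQuot.mkAlgHom K (WeylRel K n) x = RingQuot.mkAlgHom K (WeylRel K n) y :=
    fun h => RingQuot.mkAlgHom_rel K h
  rcases s with i | i <;> rcases t with j | j
  · simpa [weylGen, symp] using key (WeylRel.pp i j)
  · have := key (WeylRel.pq i j)
    rw [map_sub, map_mul, map_mul] at this
    rw [weylGen, weylGen, this]
    by_cases h : i = j <;> simp [symp, h]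
  · have := key (WeylRel.pq j i)
    rw [map_sub, map_mul, map_mul] at this
    rw [weylGen, weylGen, ← neg_sub, this]
    by_cases h : i = j <;> simp [symp, h, eq_comm]
  · simpa [weylGen, symp] using key (WeylRel.qq i j)

theorem weyl_induction {P : WeylAlgebra K n → Prop}
    (hC : ∀ c : K, P (algebraMap K _ c)) (hgen : ∀ s, P (weylGen K n s))
    (hmul : ∀ a b, P a → P b → P (a * b)) (hadd : ∀ a b, P a → P b → P (a + b))
    (a : WeylAlgebra K n) : P a := by
  obtain ⟨x, rfl⟩ := RingQuot.mkAlgHom_surjective K (WeylRel K n) a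
  induction x using FreeAlgebra.induction with
  | grade0 r => rw [AlgHom.commutes]; exact hC r
  | grade1 s => exact hgen s
  | mul x y hx hy => rw [map_mul]; exact hmul _ _ hx hy
  | add x y hx hy => rw [map_add]; exact hadd _ _ hx hy

variable (K n) in
/-- The representation of the Weyl algebra on polynomials in which a generator acts by left star
multiplication by the corresponding variable. -/
def weylRep [CharZero K] : WeylAlgebra K n →ₐ[K] Module.End K (Poly K n) :=
  RingQuot.liftAlgHom K ⟨FreeAlgebra.lift K (starLeft K n), by
    rintro _ _ (⟨i, j⟩ | ⟨i, j⟩ | ⟨i, j⟩)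
    · simp only [map_sub, map_mul, FreeAlgebra.lift_ι_apply, starLeft_commutator, symp]
      by_cases h : i = j <;> simp [h]
    · simp only [map_sub, map_mul, FreeAlgebra.lift_ι_apply, starLeft_commutator, symp, map_zero]
    · simp only [map_sub, map_mul, FreeAlgebra.lift_ι_apply, starLeft_commutator, symp, map_zero]⟩

theorem weylRep_weylGen [CharZero K] (s : Fin n ⊕ Fin n) :
    weylRep K n (weylGen K n s) = starLeft K n s := by
  simp [weylRep, weylGen]

variable (K n) in
/-- The symbol map from the Weyl algebra to polynomials: the action on `1`. -/
def symbol [CharZero K] : WeylAlgebra K n →ₗ[K] Poly K n :=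
  LinearMap.applyₗ 1 ∘ₗ (weylRep K n).toLinearMap

theorem symbol_apply [CharZero K] (a : WeylAlgebra K n) :
    symbol K n a = weylRep K n a 1 := rfl

theorem weylRep_star [CharZero K] (a : WeylAlgebra K n) (F G : Poly K n) :
    weylRep K n a (star K n F G) = star K n (weylRep K n a F) G := by
  induction a using weyl_induction generalizing F with
  | hC c => simp [AlgHom.commutes]
  | hgen s => rw [weylRep_weylGen, starLeft_star]
  | hmul a b ha hb => simp only [map_mul, Module.End.mul_apply, ha, hb]
  | hadd a b ha hb => simp only [map_add, LinearMap.add_apply, ha, hb]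

theorem weylRep_eq_star [CharZero K] (a : WeylAlgebra K n) (G : Poly K n) :
    weylRep K n a G = star K n (symbol K n a) G := by
  rw [symbol_apply, ← weylRep_star, one_star]

theorem symbol_mul [CharZero K] (a b : WeylAlgebra K n) :
    symbol K n (a * b) = star K n (symbol K n a) (symbol K n b) := by
  rw [← weylRep_eq_star, symbol_apply, symbol_apply, map_mul, Module.End.mul_apply]

theorem symbol_algebraMap [CharZero K] (c : K) :
    symbol K n (algebraMap K _ c) = MvPolynomial.C c := by
  rw [symbol_apply, AlgHom.commutes, Module.algebraMap_end_apply, smul_eq_C_mul, mul_one]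

theorem symbol_one [CharZero K] : symbol K n 1 = 1 := by
  rw [symbol_apply, map_one (weylRep K n), Module.End.one_apply]

theorem symbol_weylGen [CharZero K] (s : Fin n ⊕ Fin n) :
    symbol K n (weylGen K n s) = X s := by
  rw [symbol_apply, weylRep_weylGen, starLeft_apply, ham_one, smul_zero, add_zero, mul_one]

/-- The image contains `1` and is stable under the operators `xₛ + ½ {xₛ, ·}`, whose second term
lowers the degree. -/
theorem symbol_surjective [CharZero K] : Function.Surjective (symbol K n) := by
  intro F
  refine homog_induction (P := fun F => F ∈ LinearMap.range (symbol K n))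
    (fun F G => Submodule.add_mem _) (fun k => ?_) F
  induction k using Nat.strong_induction_on with
  | _ k ih =>
    intro F hF
    rcases k with _ | k
    · rw [totalDegree_eq_zero_iff_eq_C.1 ((totalDegree_zero_iff_isHomogeneous _).2 hF)]
      exact ⟨_, symbol_algebraMap _⟩
    · obtain ⟨G, hG, rfl⟩ := exists_eq_sum_X_mul hF
      refine Submodule.sum_mem _ fun s _ => ?_
      have h : X s * G s = starLeft K n s (G s) - (2 : K)⁻¹ • ham K n s (G s) := by
        rw [starLeft_apply, add_sub_cancel_right]
      rw [h]
      refine Submodule.sub_mem _ ?_ (Submodule.smul_mem _ _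
        (ih (k - 1) (by omega) _ (isHomogeneous_ham (hG s) s)))
      obtain ⟨a, ha⟩ := ih k (by omega) _ (hG s)
      exact ⟨weylGen K n s * a, by rw [symbol_mul, symbol_weylGen, ha, X_star]⟩

/-- The star product is associative, because it is the product of the Weyl algebra. -/
theorem star_assoc [CharZero K] (F G H : Poly K n) :
    star K n (star K n F G) H = star K n F (star K n G H) := by
  obtain ⟨a, rfl⟩ := symbol_surjective F
  obtain ⟨b, rfl⟩ := symbol_surjective G
  obtain ⟨c, rfl⟩ := symbol_surjective H
  simp only [← symbol_mul, mul_assoc]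

section BernsteinFiltration

variable {A : Type*} [Ring A] [Algebra K A] (g : Fin n ⊕ Fin n → A)

variable (K) in
/-- For a family `g` in an algebra, the span of `1` and of the elements of the family. Its powers
are the Bernstein filtration if `g` generates the algebra. -/
def bernstein : Submodule K A := 1 ⊔ Submodule.span K (Set.range g)

theorem one_le_bernstein : 1 ≤ bernstein K g := le_sup_left

theorem mem_bernstein (s : Fin n ⊕ Fin n) : g s ∈ bernstein K g :=
  le_sup_right (a := (1 : Submodule K (A))) (Submodule.subset_span ⟨s, rfl⟩)

theorem bernstein_pow_mono {d d' : ℕ} (h : d ≤ d') : bernstein K g ^ d ≤ bernstein K g ^ d' :=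
  pow_le_pow_right' (one_le_bernstein g) h

/-- Induction on the steps of the filtration by multiplication by generators on the left. -/
theorem bernstein_induction {g : Fin n ⊕ Fin n → A} {P : ℕ → A → Prop}
    (hadd : ∀ d a b, P d a → P d b → P d (a + b)) (hsmul : ∀ d (c : K) a, P d a → P d (c • a))
    (hone : P 0 1) (hmono : ∀ d, ∀ a ∈ bernstein K g ^ d, P d a → P (d + 1) a)
    (hgen : ∀ s d, ∀ a ∈ bernstein K g ^ d, P d a → P (d + 1) (g s * a))
    {d : ℕ} {a : A} (ha : a ∈ bernstein K g ^ d) : P d a := by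
  induction d generalizing a with
  | zero =>
    rw [pow_zero] at ha
    obtain ⟨c, rfl⟩ := Submodule.mem_one.1 ha
    rw [Algebra.algebraMap_eq_smul_one]
    exact hsmul _ _ _ hone
  | succ d ih =>
    rw [pow_succ'] at ha
    refine Submodule.mul_induction_on ha (fun u hu b hb => ?_) (hadd _)
    obtain ⟨x, hx, y, hy, rfl⟩ := Submodule.mem_sup.1 hu
    rw [add_mul]
    refine hadd _ _ _ ?_ ?_
    · obtain ⟨c, rfl⟩ := Submodule.mem_one.1 hx
      rw [← Algebra.smul_def]
      exact hsmul _ _ _ (hmono _ _ hb (ih hb))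
    · refine Submodule.span_induction (p := fun y _ => P (d + 1) (y * b)) ?_ ?_ ?_ ?_ hy
      · rintro _ ⟨s, rfl⟩
        exact hgen s d b hb (ih hb)
      · have := hsmul _ 0 _ (hmono _ _ hb (ih hb))
        simpa using this
      · intro y z _ _ hy hz
        rw [add_mul]; exact hadd _ _ _ hy hz
      · intro c y _ hy
        rw [smul_mul_assoc]; exact hsmul _ _ _ hy

variable {g}

/-- Commutators with generators lower the degree in the filtration. The second part covers `d = 0`,
where `d - 1` is truncated. -/
theorem commutator_mem
    (hg : ∀ s t, g s * g t - g t * g s = algebraMap K A (symp K s t))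
    (s : Fin n ⊕ Fin n) {d : ℕ} {a : A}
    (ha : a ∈ bernstein K g ^ d) :
    (g s * a - a * g s) ∈ bernstein K g ^ (d - 1) ∧
      (d = 0 → g s * a - a * g s = 0) := by
  refine bernstein_induction (g := g) (P := fun d a =>
    g s * a - a * g s ∈ bernstein K g ^ (d - 1) ∧
      (d = 0 → g s * a - a * g s = 0)) ?_ ?_ ?_ ?_ ?_ ha
  · intro d a b ha hb
    have h : g s * (a + b) - (a + b) * g s =
      (g s * a - a * g s) + (g s * b - b * g s) := by
      noncomm_ring
    rw [h]
    exact ⟨Submodule.add_mem _ ha.1 hb.1, fun hd => by rw [ha.2 hd, hb.2 hd, add_zero]⟩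
  · intro d c a ha
    rw [mul_smul_comm, smul_mul_assoc, ← smul_sub]
    exact ⟨Submodule.smul_mem _ _ ha.1, fun hd => by rw [ha.2 hd, smul_zero]⟩
  · simp
  · exact fun d a had ha => ⟨bernstein_pow_mono _ (by omega) ha.1, by simp⟩
  · intro t d a had ha
    refine ⟨?_, by simp⟩
    have h : g s * (g t * a) - g t * a * g s =
        (g s * g t - g t * g s) * a +
          g t * (g s * a - a * g s) := by
      noncomm_ring
    rw [h, hg, ← Algebra.smul_def]
    refine Submodule.add_mem _ (Submodule.smul_mem _ _ had) ?_
    rcases d with _ | d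
    · rw [ha.2 rfl, mul_zero]; exact Submodule.zero_mem _
    · simp only [Nat.add_sub_cancel] at ha ⊢
      rw [pow_succ']
      exact Submodule.mul_mem_mul (mem_bernstein g t) ha.1

variable (g) in
/-- The analogue in the Weyl algebra of the Euler operator `∑ₛ xₛ ∂/∂xₛ`. -/
def eulerOp (a : A) : A :=
  ∑ i : Fin n, (g (Sum.inr i) *
      (g (Sum.inl i) * a - a * g (Sum.inl i)) -
    g (Sum.inl i) * (g (Sum.inr i) * a - a * g (Sum.inr i)))

/-- Moving `g t` out of the Euler operator costs `g t * a` and terms of lower degree. -/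
theorem eulerOp_gen_mul
    (hg : ∀ s t, g s * g t - g t * g s = algebraMap K A (symp K s t))
    (t : Fin n ⊕ Fin n) (a : A) :
    eulerOp g (g t * a) = g t * a + g t * eulerOp g a +
      ∑ i : Fin n, (symp K (Sum.inr i) t •
          (g (Sum.inl i) * a - a * g (Sum.inl i)) -
        symp K (Sum.inl i) t •
          (g (Sum.inr i) * a - a * g (Sum.inr i))) := by
  have h0 : g t = ∑ i : Fin n, (symp K (Sum.inl i) t • g (Sum.inr i) -
      symp K (Sum.inr i) t • g (Sum.inl i)) := by
    rcases t with j | j <;> simp [symp, ite_smul]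
  have h1 : g t * a =
      ∑ i : Fin n, (symp K (Sum.inl i) t • (g (Sum.inr i) * a) -
        symp K (Sum.inr i) t • (g (Sum.inl i) * a)) := by
    conv_lhs => rw [h0]
    simp only [Finset.sum_mul, sub_mul, smul_mul_assoc]
  have hcomm : ∀ s b, g s * (g t * b) =
      g t * (g s * b) + symp K s t • b := by
    intro s b
    rw [Algebra.smul_def, ← hg]
    noncomm_ring
  calc eulerOp g (g t * a)
    _ = ∑ i : Fin n, ((symp K (Sum.inl i) t • (g (Sum.inr i) * a) -
          symp K (Sum.inr i) t • (g (Sum.inl i) * a)) +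
        g t * (g (Sum.inr i) *
          (g (Sum.inl i) * a - a * g (Sum.inl i)) -
          g (Sum.inl i) *
            (g (Sum.inr i) * a - a * g (Sum.inr i))) +
        (symp K (Sum.inr i) t • (g (Sum.inl i) * a - a * g (Sum.inl i)) -
          symp K (Sum.inl i) t •
            (g (Sum.inr i) * a - a * g (Sum.inr i)))) := by
      refine Finset.sum_congr rfl fun i _ => ?_
      simp only [hcomm, mul_sub, mul_add, mul_assoc, mul_smul_comm, smul_sub]
      abel
    _ = _ := by
      rw [Finset.sum_add_distrib, Finset.sum_add_distrib, ← h1, eulerOp, Finset.mul_sum]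

/-- On the graded pieces of the filtration the Euler operator is multiplication by the degree. -/
theorem eulerOp_sub_mem
    (hg : ∀ s t, g s * g t - g t * g s = algebraMap K A (symp K s t))
    {d : ℕ} {a : A} (ha : a ∈ bernstein K g ^ d) :
    eulerOp g a - (d : K) • a ∈ bernstein K g ^ (d - 1) := by
  have hadd : ∀ a b, eulerOp g (a + b) = eulerOp g a + eulerOp g b := by
    intro a b
    rw [eulerOp, eulerOp, eulerOp, ← Finset.sum_add_distrib]
    exact Finset.sum_congr rfl fun i _ => by noncomm_ring
  have hsmul : ∀ (c : K) a, eulerOp g (c • a) = c • eulerOp g a := by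
    intro c a
    rw [eulerOp, eulerOp, Finset.smul_sum]
    exact Finset.sum_congr rfl fun i _ => by
      simp only [mul_smul_comm, smul_mul_assoc, ← smul_sub]
  refine bernstein_induction (g := g) (P := fun d a =>
    eulerOp g a - (d : K) • a ∈ bernstein K g ^ (d - 1)) ?_ ?_ ?_ ?_ ?_ ha
  · intro d a b ha hb
    rw [hadd, smul_add, add_sub_add_comm]
    exact Submodule.add_mem _ ha hb
  · intro d c a ha
    rw [hsmul, smul_comm, ← smul_sub]
    exact Submodule.smul_mem _ _ ha
  · simp [eulerOp]
  · intro d a had ha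
    rw [Nat.cast_succ, add_smul, one_smul, ← sub_sub]
    exact Submodule.sub_mem _ (bernstein_pow_mono _ (by omega) ha) had
  · intro t d a had ha
    have h : eulerOp g (g t * a) - ((d + 1 : ℕ) : K) • (g t * a) =
        g t * (eulerOp g a - (d : K) • a) +
          ∑ i : Fin n, (symp K (Sum.inr i) t •
          (g (Sum.inl i) * a - a * g (Sum.inl i)) -
        symp K (Sum.inl i) t •
          (g (Sum.inr i) * a - a * g (Sum.inr i))) := by
      rw [eulerOp_gen_mul hg, Nat.cast_succ, add_smul, one_smul, mul_sub, mul_smul_comm]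
      abel
    rw [h, Nat.add_sub_cancel]
    refine Submodule.add_mem _ ?_ (Submodule.sum_mem _ fun i _ => Submodule.sub_mem _
      (Submodule.smul_mem _ _ (bernstein_pow_mono _ (by omega) (commutator_mem hg _ had).1))
      (Submodule.smul_mem _ _ (bernstein_pow_mono _ (by omega) (commutator_mem hg _ had).1)))
    rcases d with _ | d
    · have h0 : eulerOp g a = 0 :=
        Finset.sum_eq_zero fun i _ => by
          rw [(commutator_mem hg _ had).2 rfl, (commutator_mem hg _ had).2 rfl]; simp
      rw [h0]; simp
    · rw [pow_succ']
      exact Submodule.mul_mem_mul (mem_bernstein g t) ha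

/-- A subspace that is stable under commutators with generators satisfying the relations of the
Weyl algebra and contains no nonzero scalar meets the filtration trivially: by induction on the
filtration its elements commute with all generators, so that the Euler operator kills them. -/
theorem eq_zero_of_commutator_stable [CharZero K]
    (hg : ∀ s t, g s * g t - g t * g s = algebraMap K A (symp K s t)) (N : Submodule K A)
    (hN : ∀ s, ∀ a ∈ N, g s * a - a * g s ∈ N) (hC : ∀ c : K, algebraMap K A c ∈ N → c = 0)
    {d : ℕ} {a : A} (ha : a ∈ bernstein K g ^ d) (haN : a ∈ N) : a = 0 := by
  induction d generalizing a with
  | zero =>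
    rw [pow_zero] at ha
    obtain ⟨c, rfl⟩ := Submodule.mem_one.1 ha
    rw [hC c haN, map_zero]
  | succ d ih =>
    have hc : ∀ s, g s * a - a * g s = 0 := fun s =>
      ih (commutator_mem hg s ha).1 (hN s a haN)
    have hE : eulerOp g a = 0 := Finset.sum_eq_zero fun i _ => by rw [hc, hc]; simp
    have hd : ((d + 1 : ℕ) : K) ≠ 0 := Nat.cast_ne_zero.2 d.succ_ne_zero
    have := eulerOp_sub_mem hg ha
    rw [hE, zero_sub] at this
    exact ih ((Submodule.smul_mem_iff _ hd).1 (neg_mem_iff.1 this)) haN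

end BernsteinFiltration

theorem exists_mem_bernstein_pow (a : WeylAlgebra K n) :
    ∃ d, a ∈ bernstein K (weylGen K n) ^ d := by
  induction a using weyl_induction with
  | hC c => exact ⟨0, by rw [pow_zero]; exact Submodule.algebraMap_mem c⟩
  | hgen s => exact ⟨1, by rw [pow_one]; exact mem_bernstein _ s⟩
  | hmul a b ha hb =>
    obtain ⟨d, hd⟩ := ha
    obtain ⟨d', hd'⟩ := hb
    exact ⟨d + d', by rw [pow_add]; exact Submodule.mul_mem_mul hd hd'⟩
  | hadd a b ha hb =>
    obtain ⟨d, hd⟩ := ha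
    obtain ⟨d', hd'⟩ := hb
    exact ⟨max d d', Submodule.add_mem _ (bernstein_pow_mono _ (le_max_left _ _) hd)
      (bernstein_pow_mono _ (le_max_right _ _) hd')⟩

theorem symbol_injective [CharZero K] : Function.Injective (symbol K n) := by
  rw [injective_iff_map_eq_zero]
  intro a h
  obtain ⟨d, hd⟩ := exists_mem_bernstein_pow a
  refine eq_zero_of_commutator_stable weylGen_commutator (LinearMap.ker (symbol K n))
    (fun s a ha => ?_) (fun c hc => ?_) hd h
  · rw [LinearMap.mem_ker] at ha ⊢
    rw [map_sub, symbol_mul, symbol_mul, ha, map_zero, map_zero, LinearMap.zero_apply, sub_zero]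
  · rwa [LinearMap.mem_ker, symbol_algebraMap, MvPolynomial.C_eq_zero] at hc

variable (K n) in
/-- The polynomials with the star product are the Weyl algebra. -/
def symbolEquiv [CharZero K] : WeylAlgebra K n ≃ₗ[K] Poly K n :=
  LinearEquiv.ofBijective (symbol K n) ⟨symbol_injective, symbol_surjective⟩

/-! ### Signs and parity of the star product -/

theorem zmod_two_cases (f : ZMod 2) : f = 0 ∨ f = 1 := by
  revert f; decide

@[simp] theorem sign_zero_left (f : ZMod 2) : sign K 0 f = 1 := by simp [sign]

@[simp] theorem sign_zero_right (f : ZMod 2) : sign K f 0 = 1 := by simp [sign]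

@[simp] theorem sign_one_one : sign K 1 1 = -1 := by simp [sign, ZMod.val_one]

theorem sign_add_right (f g h : ZMod 2) : sign K f (g + h) = sign K f g * sign K f h := by
  have h2 : (1 + 1 : ZMod 2) = 0 := rfl
  rcases zmod_two_cases f with rfl | rfl <;> rcases zmod_two_cases g with rfl | rfl <;>
    rcases zmod_two_cases h with rfl | rfl <;> simp [h2]

theorem sign_mul_self (f g : ZMod 2) : sign K f g * sign K f g = 1 := by
  rcases zmod_two_cases f with rfl | rfl <;> rcases zmod_two_cases g with rfl | rfl <;> simp

theorem sign_natCast_self (k : ℕ) : sign K (k : ZMod 2) (k : ZMod 2) = (-1) ^ k := by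
  rcases Nat.even_or_odd k with h | h
  · rw [(ZMod.natCast_eq_zero_iff_even).2 h, sign_zero_left, h.neg_one_pow]
  · rw [(ZMod.natCast_eq_one_iff_odd).2 h, sign_one_one, h.neg_one_pow]

theorem X_mem_parity (s : Fin n ⊕ Fin n) : (X s : Poly K n) ∈ parity K n 1 := by
  simpa using mem_parity (isHomogeneous_X K s)

theorem parity_star [CharZero K] {f g : ZMod 2} {F G : Poly K n} (hF : F ∈ parity K n f)
    (hG : G ∈ parity K n g) : star K n F G ∈ parity K n (f + g) := by
  refine parity_induction (P := fun F => star K n F G ∈ parity K n (f + g)) (by simp)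
    (fun F F' h h' => by rw [map_add]; exact Submodule.add_mem _ h h') ?_ hF
  rintro k F rfl hF
  clear * - hF hG
  induction k generalizing F G g with
  | zero =>
    rw [totalDegree_eq_zero_iff_eq_C.1 ((totalDegree_zero_iff_isHomogeneous _).2 hF), C_star]
    simpa using Submodule.smul_mem _ _ hG
  | succ k ih =>
    obtain ⟨E, hE, rfl⟩ := exists_eq_sum_X_mul hF
    rw [map_sum, LinearMap.sum_apply]
    refine Submodule.sum_mem _ fun s _ => ?_
    rw [star_X_mul]
    refine Submodule.add_mem _ ?_ (Submodule.smul_mem _ _ ?_)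
    · convert parity_X_mul (ih hG _ (hE s)) s using 2
      push_cast; ring
    · convert ih (parity_ham hG s) _ (hE s) using 2
      push_cast; ring

/-! ### The supertrace and the form `κ` -/

theorem Str_C (c : K) : Str K n (MvPolynomial.C c) = c := by
  simp [Str]

theorem Str_X_mul (s : Fin n ⊕ Fin n) (F : Poly K n) : Str K n (X s * F) = 0 := by
  simp [Str]

theorem Str_eq_zero [CharZero K] {k : ℕ} {F : Poly K n} (hF : F.IsHomogeneous (k + 1)) :
    Str K n F = 0 := by
  obtain ⟨G, -, rfl⟩ := exists_eq_sum_X_mul hF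
  rw [map_sum]
  exact Finset.sum_eq_zero fun s _ => Str_X_mul s _

theorem Str_odd [CharZero K] {F : Poly K n} (hF : F ∈ parity K n 1) : Str K n F = 0 := by
  refine parity_induction (P := fun F => Str K n F = 0) (map_zero _)
    (fun F G hF hG => by rw [map_add, hF, hG, add_zero]) ?_ hF
  rintro (_ | k) F hk hF
  · simp at hk
  · exact Str_eq_zero hF

/-- A property that is preserved by sums holds on the kernel of the supertrace as soon as it
holds for homogeneous polynomials of positive degree. -/
theorem ker_Str_induction [CharZero K] {P : Poly K n → Prop} (h0 : P 0)
    (hadd : ∀ F G, P F → P G → P (F + G))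
    (hP : ∀ (k : ℕ) (F : Poly K n), F.IsHomogeneous (k + 1) → P F) {F : Poly K n}
    (hF : Str K n F = 0) : P F := by
  have key : P (F - MvPolynomial.C (Str K n F)) := by
    refine homog_induction (P := fun F => P (F - MvPolynomial.C (Str K n F)))
      (fun F G hF hG => ?_) ?_ F
    · rw [map_add, map_add, add_sub_add_comm]
      exact hadd _ _ hF hG
    · rintro (_ | k) F hF
      · rw [totalDegree_eq_zero_iff_eq_C.1 ((totalDegree_zero_iff_isHomogeneous _).2 hF), Str_C,
          sub_self]
        exact h0
      · rw [Str_eq_zero hF, map_zero, sub_zero]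
        exact hP k F hF
  rwa [hF, map_zero, sub_zero] at key

theorem kappa_apply (F G : Poly K n) : kappa K n F G = Str K n (star K n F G) := rfl

theorem kappa_C (c : K) (G : Poly K n) : kappa K n (MvPolynomial.C c) G = c * Str K n G := by
  rw [kappa_apply, C_star, map_smul, smul_eq_mul]

theorem kappa_X_mul [CharZero K] (s : Fin n ⊕ Fin n) (F G : Poly K n) :
    kappa K n (X s * F) G = (2 : K)⁻¹ * kappa K n F (ham K n s G) := by
  rw [kappa_apply, star_X_mul, map_add, Str_X_mul, zero_add, map_smul, smul_eq_mul, kappa_apply]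

theorem kappa_mul_X [CharZero K] (s : Fin n ⊕ Fin n) (F G : Poly K n) :
    kappa K n F (X s * G) = -((2 : K)⁻¹ * kappa K n (ham K n s F) G) := by
  rw [kappa_apply, star_mul_X, map_sub, Str_X_mul, zero_sub, map_smul, smul_eq_mul, kappa_apply]

theorem kappa_eq_zero [CharZero K] {l m : ℕ} (hlm : l ≠ m) {F G : Poly K n}
    (hF : F.IsHomogeneous l) (hG : G.IsHomogeneous m) : kappa K n F G = 0 := by
  induction l generalizing m F G with
  | zero =>
    obtain ⟨m, rfl⟩ := Nat.exists_eq_succ_of_ne_zero hlm.symm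
    rw [totalDegree_eq_zero_iff_eq_C.1 ((totalDegree_zero_iff_isHomogeneous _).2 hF), kappa_C,
      Str_eq_zero hG, mul_zero]
  | succ l ih =>
    obtain ⟨E, hE, rfl⟩ := exists_eq_sum_X_mul hF
    rw [map_sum, LinearMap.sum_apply]
    refine Finset.sum_eq_zero fun s _ => ?_
    rw [kappa_X_mul]
    rcases m with _ | m
    · rw [totalDegree_eq_zero_iff_eq_C.1 ((totalDegree_zero_iff_isHomogeneous _).2 hG), ham_C,
        map_zero, mul_zero]
    · rw [ih (by omega) (hE s) (isHomogeneous_ham hG s), mul_zero]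

/-- On `S^l` the form `κ` is symmetric or antisymmetric according to the parity of `l`. -/
theorem kappa_swap [CharZero K] {l : ℕ} {F G : Poly K n}
    (hF : F.IsHomogeneous l) (hG : G.IsHomogeneous l) :
    kappa K n G F = (-1) ^ l * kappa K n F G := by
  induction l generalizing F G with
  | zero =>
    rw [totalDegree_eq_zero_iff_eq_C.1 ((totalDegree_zero_iff_isHomogeneous _).2 hF),
      totalDegree_eq_zero_iff_eq_C.1 ((totalDegree_zero_iff_isHomogeneous _).2 hG), kappa_C,
      kappa_C, Str_C, Str_C, pow_zero, one_mul, mul_comm]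
  | succ l ih =>
    obtain ⟨E, hE, rfl⟩ := exists_eq_sum_X_mul hF
    rw [map_sum, map_sum, LinearMap.sum_apply, Finset.mul_sum]
    refine Finset.sum_congr rfl fun s _ => ?_
    rw [kappa_X_mul, kappa_mul_X, ih (hE s) (isHomogeneous_ham hG s)]
    ring

theorem kappa_supersymmetric [CharZero K] : IsSupersymmetric (kappa K n) := by
  intro f g F hF G hG
  refine parity_induction (P := fun F => kappa K n G F = sign K f g * kappa K n F G) (by simp)
    (fun F F' h h' => by rw [map_add, map_add, LinearMap.add_apply, h, h', mul_add]) ?_ hF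
  rintro k F rfl hF
  refine parity_induction (P := fun G => kappa K n G F = sign K k g * kappa K n F G) (by simp)
    (fun F F' h h' => by rw [map_add, map_add, LinearMap.add_apply, h, h', mul_add]) ?_ hG
  rintro m G rfl hG
  rcases eq_or_ne k m with rfl | h
  · rw [kappa_swap hF hG, sign_natCast_self]
  · rw [kappa_eq_zero h hF hG, kappa_eq_zero h.symm hG hF, mul_zero]

/-- Both radicals of `κ` are stable under Hamiltonian derivations of variables and contain no
nonzero constant. -/
theorem kappa_nondegenerate [CharZero K] : (kappa K n).Nondegenerate := by
  constructor
  · intro F hF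
    refine eq_zero_of_ham_stable (LinearMap.ker (kappa K n)) (fun s F hF => ?_) (fun c hc => ?_)
      (LinearMap.mem_ker.2 (LinearMap.ext hF))
    · refine LinearMap.mem_ker.2 (LinearMap.ext fun G => ?_)
      have h := kappa_mul_X s F G
      rw [LinearMap.mem_ker.1 hF, LinearMap.zero_apply] at h
      simpa using h
    · have h := kappa_C c (1 : Poly K n)
      rw [LinearMap.mem_ker.1 hc, ← MvPolynomial.C_1, Str_C] at h
      simpa using h.symm
  · intro G hG
    refine eq_zero_of_ham_stable (LinearMap.ker (LinearMap.flip (kappa K n))) (fun s G hG => ?_)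
      (fun c hc => ?_) (LinearMap.mem_ker.2 (LinearMap.ext hG))
    · refine LinearMap.mem_ker.2 (LinearMap.ext fun F => ?_)
      have h := kappa_X_mul s F G
      rw [← LinearMap.flip_apply, LinearMap.mem_ker.1 hG, LinearMap.zero_apply] at h
      simpa using h
    · have h := kappa_C (1 : K) (MvPolynomial.C c : Poly K n)
      rw [← LinearMap.flip_apply, LinearMap.mem_ker.1 hc, Str_C] at h
      simpa using h.symm

theorem kappa_restrict_nondegenerate [CharZero K] (l : ℕ) :
    ((kappa K n).restrict (homog K n l)).Nondegenerate := by
  constructor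
  · rintro ⟨F, hF⟩ h
    refine Subtype.ext (kappa_nondegenerate.1 F fun G => ?_)
    refine homog_induction (P := fun G => kappa K n F G = 0)
      (fun G G' h h' => by rw [map_add, h, h', add_zero]) (fun m G hG => ?_) G
    rcases eq_or_ne l m with rfl | hlm
    · exact h ⟨G, hG⟩
    · exact kappa_eq_zero hlm hF hG
  · rintro ⟨G, hG⟩ h
    refine Subtype.ext (kappa_nondegenerate.2 G fun F => ?_)
    refine homog_induction (P := fun F => kappa K n F G = 0)
      (fun F F' h h' => by rw [map_add, LinearMap.add_apply, h, h', add_zero])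
      (fun m F hF => ?_) F
    rcases eq_or_ne m l with rfl | hlm
    · exact h ⟨F, hF⟩
    · exact kappa_eq_zero hlm hF hG

/-! ### The super bracket -/

theorem bracket_eq {f g : ZMod 2} {F G : Poly K n} (hF : F ∈ parity K n f)
    (hG : G ∈ parity K n g) :
    bracket K n F G = star K n F G - sign K f g • star K n G F := by
  have hp : ∀ i, parityProj K n i F = if i = f then F else 0 := fun i =>
    weightedHomogeneousComponent_of_mem hF
  have hq : ∀ i, parityProj K n i G = if i = g then G else 0 := fun i =>
    weightedHomogeneousComponent_of_mem hG
  simp only [bracket, LinearMap.sum_apply, LinearMap.sub_apply, LinearMap.smul_apply,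
    LinearMap.compl₁₂_apply, LinearMap.flip_apply, hp, hq]
  rw [Finset.sum_eq_single f, Finset.sum_eq_single g]
  · simp
  · intro i _ hi; simp [hi]
  · simp
  · intro i _ hi; simp [hi]
  · simp

/-- Invariance follows from associativity and supersymmetry. -/
theorem kappa_adInvariant [CharZero K] : IsAdInvariant (kappa K n) := by
  intro f g F hF G hG H
  refine homog_induction (P := fun H => kappa K n (bracket K n F G) H +
    sign K f g * kappa K n G (bracket K n F H) = 0) (fun H H' h h' => ?_) (fun k H hH => ?_) H
  · simp only [map_add]
    linear_combination h + h'
  · rw [bracket_eq hF hG, bracket_eq hF (mem_parity hH)]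
    have h1 : kappa K n (star K n F G) H = kappa K n F (star K n G H) := by
      rw [kappa_apply, kappa_apply, star_assoc]
    have h2 : kappa K n (star K n G F) H = kappa K n G (star K n F H) := by
      rw [kappa_apply, kappa_apply, star_assoc]
    have h3 : kappa K n G (star K n H F) = kappa K n (star K n G H) F := by
      rw [kappa_apply, kappa_apply, star_assoc]
    have h4 := kappa_supersymmetric f (g + k) F hF _ (parity_star hG (mem_parity hH))
    rw [sign_add_right] at h4
    simp only [map_sub, map_smul, LinearMap.sub_apply, LinearMap.smul_apply, smul_eq_mul, h1, h2,
      h3, h4]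
    have h5 := sign_mul_self (K := K) f g
    have h6 := sign_mul_self (K := K) f k
    linear_combination (-kappa K n F (star K n G H)) * (h5 * sign K f k * sign K f k + h6)

theorem Str_bracket [CharZero K] (F G : Poly K n) : Str K n (bracket K n F G) = 0 := by
  refine homog_induction (P := fun F => Str K n (bracket K n F G) = 0)
    (fun F F' h h' => by rw [map_add, LinearMap.add_apply, map_add, h, h', add_zero])
    (fun k F hF => ?_) F
  refine homog_induction (P := fun G => Str K n (bracket K n F G) = 0)
    (fun F F' h h' => by rw [map_add, map_add, h, h', add_zero]) (fun m G hG => ?_) G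
  have h := kappa_supersymmetric _ _ F (mem_parity hF) G (mem_parity hG)
  rw [bracket_eq (mem_parity hF) (mem_parity hG), map_sub, map_smul, ← kappa_apply, ← kappa_apply,
    h, smul_eq_mul, ← mul_assoc, sign_mul_self, one_mul, sub_self]

/-- The bracket of a variable with an even polynomial is the Hamiltonian derivation. -/
theorem bracket_X_even [CharZero K] (s : Fin n ⊕ Fin n) {G : Poly K n} (hG : G ∈ parity K n 0) :
    bracket K n (X s) G = ham K n s G := by
  rw [bracket_eq (X_mem_parity s) hG, X_star, star_X, sign_zero_right, one_smul, starLeft_apply,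
    starRight_apply, add_sub_sub_cancel, ← add_smul, ← two_mul, mul_inv_cancel₀ two_ne_zero,
    one_smul]

/-- The bracket of a variable with an odd polynomial is twice the commutative product. -/
theorem bracket_X_odd [CharZero K] (s : Fin n ⊕ Fin n) {G : Poly K n} (hG : G ∈ parity K n 1) :
    bracket K n (X s) G = (2 : K) • (X s * G) := by
  rw [bracket_eq (X_mem_parity s) hG, X_star, star_X, sign_one_one, neg_one_smul, sub_neg_eq_add,
    starLeft_apply, starRight_apply, add_add_sub_cancel, two_smul]

/-- An even `xₛ G` is half the bracket of `xₛ` with the odd `G`; an odd polynomial is the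
Hamiltonian derivation `{xₛ, H}` of an even `H`, hence a bracket as well. -/
theorem mem_derived_of_isHomogeneous [CharZero K] {k : ℕ} {F : Poly K n}
    (hF : F.IsHomogeneous (k + 1)) : F ∈ derived K n := by
  obtain ⟨G, hG, rfl⟩ := exists_eq_sum_X_mul hF
  refine Submodule.sum_mem _ fun s _ => ?_
  rcases Nat.even_or_odd k with h | h
  · obtain ⟨H, hH, h'⟩ := exists_ham_eq (isHomogeneous_X_mul (hG s) s) s
    refine Submodule.subset_span ⟨X s, H, ?_⟩
    have := mem_parity hH
    rw [ZMod.natCast_eq_zero_iff_even.2 (h.add_one.add_one)] at this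
    rw [bracket_X_even s this, h']
  · have := mem_parity (hG s)
    rw [ZMod.natCast_eq_one_iff_odd.2 h] at this
    refine Submodule.subset_span ⟨(2 : K)⁻¹ • X s, G s, ?_⟩
    rw [map_smul, LinearMap.smul_apply, bracket_X_odd s this, smul_smul,
      inv_mul_cancel₀ two_ne_zero, one_smul]

theorem ker_Str [CharZero K] : LinearMap.ker (Str K n) = derived K n := by
  refine le_antisymm (fun F hF => ?_) (Submodule.span_le.2 ?_)
  · exact ker_Str_induction (P := fun F => F ∈ derived K n) (Submodule.zero_mem _)
      (fun F G => Submodule.add_mem _) (fun k F => mem_derived_of_isHomogeneous) hF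
  · rintro _ ⟨F, G, rfl⟩
    exact Str_bracket F G

/-! ### Uniqueness of the invariant form -/

theorem X_mul_mem_even {G : Poly K n} (hG : G ∈ parity K n 1) (s : Fin n ⊕ Fin n) :
    X s * G ∈ parity K n 0 := parity_X_mul hG s

theorem X_mul_mem_odd {G : Poly K n} (hG : G ∈ parity K n 0) (s : Fin n ⊕ Fin n) :
    X s * G ∈ parity K n 1 := parity_X_mul hG s

theorem ham_mem_even {G : Poly K n} (hG : G ∈ parity K n 1) (s : Fin n ⊕ Fin n) :
    ham K n s G ∈ parity K n 0 := parity_ham hG s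

theorem ham_mem_odd {G : Poly K n} (hG : G ∈ parity K n 0) (s : Fin n ⊕ Fin n) :
    ham K n s G ∈ parity K n 1 := by
  simpa using parity_ham hG s

/-- Euler's identity, with partial derivatives written as Hamiltonian derivations. -/
theorem sum_X_mul_ham {k : ℕ} {F : Poly K n} (hF : F.IsHomogeneous k) :
    ∑ i : Fin n, (X (Sum.inr i) * ham K n (Sum.inl i) F -
      X (Sum.inl i) * ham K n (Sum.inr i) F) = (k : K) • F := by
  rw [← sum_X_mul_pd hF, Fintype.sum_sum_type, ← Finset.sum_add_distrib]
  refine Finset.sum_congr rfl fun i _ => ?_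
  simp only [ham, LinearMap.neg_apply]
  ring

/-- The cube of a variable, in the commutative product, is also its cube for the star product. -/
theorem cube_star [CharZero K] (s : Fin n ⊕ Fin n) (G : Poly K n) :
    star K n (X s * (X s * X s)) G = starLeft K n s (starLeft K n s (starLeft K n s G)) := by
  have h1 : X s * X s = starLeft K n s (X s) := by
    have := ham_X_self_mul (K := K) s 1
    rw [ham_one, mul_one, mul_zero] at this
    rw [starLeft_apply, this, smul_zero, add_zero]
  have h2 : X s * (X s * X s) = starLeft K n s (starLeft K n s (X s)) := by
    rw [← h1, starLeft_apply, ham_X_self_mul]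
    have := ham_X_self_mul (K := K) s 1
    rw [ham_one, mul_one, mul_zero] at this
    rw [this, mul_zero, smul_zero, add_zero]
  rw [h2, starLeft_star, starLeft_star, X_star]

theorem star_cube [CharZero K] (s : Fin n ⊕ Fin n) (G : Poly K n) :
    star K n G (X s * (X s * X s)) = starRight K n s (starRight K n s (starRight K n s G)) := by
  have h1 : X s * X s = starRight K n s (X s) := by
    have := ham_X_self_mul (K := K) s 1
    rw [ham_one, mul_one, mul_zero] at this
    rw [starRight_apply, this, smul_zero, sub_zero]
  have h2 : X s * (X s * X s) = starRight K n s (starRight K n s (X s)) := by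
    rw [← h1, starRight_apply, ham_X_self_mul]
    have := ham_X_self_mul (K := K) s 1
    rw [ham_one, mul_one, mul_zero] at this
    rw [this, mul_zero, smul_zero, sub_zero]
  rw [h2, star_starRight, star_starRight, star_X]

theorem cube_mem_parity (s : Fin n ⊕ Fin n) : (X s * (X s * X s) : Poly K n) ∈ parity K n 1 :=
  X_mul_mem_odd (X_mul_mem_even (X_mem_parity s) s) s

theorem bracket_cube_even [CharZero K] (s : Fin n ⊕ Fin n) {G : Poly K n}
    (hG : G ∈ parity K n 0) :
    bracket K n (X s * (X s * X s)) G = (3 : K) • (X s * (X s * ham K n s G)) +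
      (4 : K)⁻¹ • ham K n s (ham K n s (ham K n s G)) := by
  have h4 : (4 : K)⁻¹ = 2⁻¹ * 2⁻¹ := by norm_num
  rw [bracket_eq (cube_mem_parity s) hG, cube_star, star_cube, sign_zero_right, one_smul]
  simp only [starLeft_apply, starRight_apply, map_add, map_sub, map_smul, ham_X_self_mul, h4]
  simp only [smul_eq_C_mul, map_mul, map_ofNat]
  have h := C_half_mul_two (K := K) (n := n)
  generalize (MvPolynomial.C (2 : K)⁻¹ : Poly K n) = c at h ⊢
  linear_combination (3 * X s ^ 2 * ham K n s G + c ^ 2 * ham K n s (ham K n s (ham K n s G))) * h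

theorem bracket_cube_odd [CharZero K] (s : Fin n ⊕ Fin n) {G : Poly K n}
    (hG : G ∈ parity K n 1) :
    bracket K n (X s * (X s * X s)) G = (2 : K) • (X s * (X s * (X s * G))) +
      ((3 : K) * 2⁻¹) • (X s * ham K n s (ham K n s G)) := by
  rw [bracket_eq (cube_mem_parity s) hG, cube_star, star_cube, sign_one_one, neg_one_smul]
  simp only [starLeft_apply, starRight_apply, map_add, map_sub, map_smul, ham_X_self_mul]
  simp only [smul_eq_C_mul, map_mul, map_ofNat]
  have h := C_half_mul_two (K := K) (n := n)
  generalize (MvPolynomial.C (2 : K)⁻¹ : Poly K n) = c at h ⊢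
  linear_combination (3 * c * X s * ham K n s (ham K n s G)) * h

section Invariant

variable [CharZero K] {B : LinearMap.BilinForm K (Poly K n)} (hB : IsAdInvariant B)

include hB

theorem ham_even_even (s : Fin n ⊕ Fin n) {G H : Poly K n}
    (hG : G ∈ parity K n 0) (hH : H ∈ parity K n 0) :
    B (ham K n s G) H = -B G (ham K n s H) := by
  have := hB 1 0 _ (X_mem_parity s) G hG H
  rw [bracket_X_even s hG, bracket_X_even s hH, sign_zero_right, one_mul] at this
  exact eq_neg_of_add_eq_zero_left this

theorem ham_even_odd (s : Fin n ⊕ Fin n) {G H : Poly K n}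
    (hG : G ∈ parity K n 0) (hH : H ∈ parity K n 1) :
    B (ham K n s G) H = -(2 * B G (X s * H)) := by
  have := hB 1 0 _ (X_mem_parity s) G hG H
  rw [bracket_X_even s hG, bracket_X_odd s hH, sign_zero_right, one_mul, map_smul,
    smul_eq_mul] at this
  exact eq_neg_of_add_eq_zero_left this

theorem X_mul_odd_even (s : Fin n ⊕ Fin n) {G H : Poly K n}
    (hG : G ∈ parity K n 1) (hH : H ∈ parity K n 0) :
    2 * B (X s * G) H = B G (ham K n s H) := by
  have := hB 1 1 _ (X_mem_parity s) G hG H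
  rw [bracket_X_odd s hG, bracket_X_even s hH, sign_one_one, map_smul, LinearMap.smul_apply,
    smul_eq_mul] at this
  linear_combination this

theorem X_mul_odd_odd (s : Fin n ⊕ Fin n) {G H : Poly K n}
    (hG : G ∈ parity K n 1) (hH : H ∈ parity K n 1) :
    B (X s * G) H = B G (X s * H) := by
  have := hB 1 1 _ (X_mem_parity s) G hG H
  rw [bracket_X_odd s hG, bracket_X_odd s hH, sign_one_one, map_smul, LinearMap.smul_apply,
    map_smul, smul_eq_mul, smul_eq_mul] at this
  have h2 : (2 : K) ≠ 0 := two_ne_zero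
  exact mul_left_cancel₀ h2 (by linear_combination this)

/-- The operators `xₜ {xₛ, ·}`, which generate the adjoint action of quadratic polynomials,
are skew up to exchanging `s` and `t`. -/
theorem X_mul_ham_odd_odd (s t : Fin n ⊕ Fin n) {G H : Poly K n}
    (hG : G ∈ parity K n 1) (hH : H ∈ parity K n 1) :
    B (X t * ham K n s G) H = -B G (X s * ham K n t H) := by
  have h1 := ham_even_odd hB s (X_mul_mem_even hG t) hH
  have h2 := X_mul_odd_even hB t hG (X_mul_mem_even hH s)
  rw [h2, ham_X_mul, ham_X_mul, symp_swap s t, map_add, map_add, map_smul, map_smul,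
    LinearMap.add_apply, LinearMap.smul_apply, smul_eq_mul, smul_eq_mul] at h1
  linear_combination h1

/-- The Euler operator is self-adjoint on the odd part for an invariant form, so odd components of
different degrees are orthogonal. -/
theorem odd_odd_eq_zero_of_ne {a b : ℕ} (hab : a ≠ b) {G H : Poly K n}
    (hG : G ∈ parity K n 1) (hH : H ∈ parity K n 1)
    (hGa : G.IsHomogeneous a) (hHb : H.IsHomogeneous b) : B G H = 0 := by
  have h : B ((a : K) • G) H = B G ((b : K) • H) := by
    rw [← sum_X_mul_ham hGa, ← sum_X_mul_ham hHb, map_sum, map_sum, LinearMap.sum_apply]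
    refine Finset.sum_congr rfl fun i _ => ?_
    rw [map_sub, map_sub, LinearMap.sub_apply, X_mul_ham_odd_odd hB _ _ hG hH,
      X_mul_ham_odd_odd hB _ _ hG hH]
    ring
  rw [map_smul, map_smul, LinearMap.smul_apply, smul_eq_mul, smul_eq_mul] at h
  have h' : ((a : K) - b) * B G H = 0 := by linear_combination h
  exact (mul_eq_zero.1 h').resolve_left (sub_ne_zero.2 (Nat.cast_injective.ne hab))

/-- On an even and an odd polynomial the adjoint of the Euler operator is `-(E + 2n)`, so that
`(a + b + 1 + 2n) B(G, H) = 0`. -/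
theorem even_odd_eq_zero {a b : ℕ} {G H : Poly K n}
    (hG : G ∈ parity K n 0) (hH : H ∈ parity K n 1)
    (hGa : G.IsHomogeneous a) (hHb : H.IsHomogeneous (b + 1)) : B G H = 0 := by
  have h : B ((a : K) • G) H = ∑ _i : Fin n, -(2 * B G H) - B G (((b + 1 : ℕ) : K) • H) := by
    rw [← sum_X_mul_ham hGa, ← sum_X_mul_ham hHb, map_sum, map_sum, LinearMap.sum_apply,
      ← Finset.sum_sub_distrib]
    refine Finset.sum_congr rfl fun i _ => ?_
    rw [map_sub, map_sub, LinearMap.sub_apply, X_mul_odd_odd hB _ (ham_mem_odd hG _) hH,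
      X_mul_odd_odd hB _ (ham_mem_odd hG _) hH, ham_even_even hB _ hG (X_mul_mem_even hH _),
      ham_even_even hB _ hG (X_mul_mem_even hH _), ham_X_mul, ham_X_mul, map_add, map_add,
      map_smul, map_smul]
    simp only [symp, if_true, smul_eq_mul]
    ring
  rw [map_smul, map_smul, LinearMap.smul_apply, smul_eq_mul, smul_eq_mul, Finset.sum_const,
    Finset.card_univ, Fintype.card_fin, nsmul_eq_mul] at h
  have h' : ((a + (b + 1) + 2 * n : ℕ) : K) * B G H = 0 := by
    push_cast at h ⊢
    linear_combination h
  exact (mul_eq_zero.1 h').resolve_left (Nat.cast_ne_zero.2 (by omega))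

theorem odd_even_eq_zero {a b : ℕ} {G H : Poly K n} (hb : Even b)
    (hG : G ∈ parity K n 1) (hGa : G.IsHomogeneous a) (hHb : H.IsHomogeneous b) (hb0 : b ≠ 0) :
    B G H = 0 := by
  obtain ⟨b, rfl⟩ := Nat.exists_eq_succ_of_ne_zero hb0
  obtain ⟨E, hE, rfl⟩ := exists_eq_sum_X_mul hHb
  rw [map_sum]
  refine Finset.sum_eq_zero fun s _ => ?_
  have hbo : Odd b := by rwa [Nat.succ_eq_add_one, Nat.even_add_one, Nat.not_even_iff_odd] at hb
  have hEs := mem_parity (hE s)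
  rw [ZMod.natCast_eq_one_iff_odd.2 hbo] at hEs
  rw [← X_mul_odd_odd hB s hG hEs]
  obtain ⟨b, rfl⟩ := Nat.exists_eq_succ_of_ne_zero hbo.pos.ne'
  exact even_odd_eq_zero hB (X_mul_mem_even hG s) hEs (isHomogeneous_X_mul hGa s) (hE s)

/-- Invariance under the cube of a variable passes from the odd degree `d` to `d + 2`: up to
components that are orthogonal for degree reasons it says that `3 B(x² N, H) = ¾ B(N, {x, {x, H}})`
for `x = xₛ`. -/
theorem X_mul_X_self_mul_eq_zero {d : ℕ} (hd : Odd d)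
    (h0 : ∀ N H : Poly K n, N.IsHomogeneous d → H.IsHomogeneous d → B N H = 0)
    (s : Fin n ⊕ Fin n) {N H : Poly K n} (hN : N.IsHomogeneous d)
    (hH : H.IsHomogeneous (d + 2)) : B (X s * (X s * N)) H = 0 := by
  have hN1 := mem_parity hN
  have hH1 := mem_parity hH
  rw [ZMod.natCast_eq_one_iff_odd.2 hd] at hN1
  rw [ZMod.natCast_eq_one_iff_odd.2 (hd.add_even even_two)] at hH1
  obtain ⟨M, hM, rfl⟩ := exists_ham_eq hN s
  have hM0 := mem_parity hM
  rw [ZMod.natCast_eq_zero_iff_even.2 (hd.add_odd odd_one)] at hM0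
  have h := hB 1 0 _ (cube_mem_parity s) M hM0 H
  have e1 : B (ham K n s (ham K n s (ham K n s M))) H = 0 :=
    odd_odd_eq_zero_of_ne hB (a := d - 1 - 1) (b := d + 2) (by omega)
      (ham_mem_odd (ham_mem_even hN1 s) s) hH1
      (isHomogeneous_ham (isHomogeneous_ham hN s) s) hH
  have e2 : B (ham K n s M) (X s * (X s * H)) = 0 :=
    odd_odd_eq_zero_of_ne hB (a := d) (b := d + 2 + 1 + 1) (by omega) hN1
      (X_mul_mem_odd (X_mul_mem_even hH1 s) s) hN
      (isHomogeneous_X_mul (isHomogeneous_X_mul hH s) s)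
  have e3 : B (ham K n s M) (ham K n s (ham K n s H)) = 0 :=
    h0 _ _ hN (isHomogeneous_ham (isHomogeneous_ham hH s) s)
  rw [ham_even_odd hB s hM0 (X_mul_mem_odd (X_mul_mem_even hH1 s) s)] at e2
  rw [ham_even_odd hB s hM0 (ham_mem_odd (ham_mem_even hH1 s) s)] at e3
  rw [bracket_cube_even s hM0, bracket_cube_odd s hH1, sign_zero_right, one_mul, map_add, map_add,
    map_smul, map_smul, map_smul, map_smul, LinearMap.add_apply, LinearMap.smul_apply,
    LinearMap.smul_apply, smul_eq_mul, smul_eq_mul, smul_eq_mul, smul_eq_mul, e1] at h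
  have h2 : (2 : K) ≠ 0 := two_ne_zero
  have e3' : B M (X s * ham K n s (ham K n s H)) = 0 := by simpa using e3
  have h3 : (3 : K) * B (X s * (X s * ham K n s M)) H = 0 := by
    linear_combination h + e2 - 3 * 2⁻¹ * e3'
  simpa using h3

/-- Induction on the odd degree. Polynomials `xₛ² N` are covered by the cubic relation, and
`X_mul_ham_odd_odd` carries them to all `xₛ xₜ N`, which span. -/
theorem odd_odd_eq_zero (h1 : ∀ s t, B (X s) (X t) = 0) (j : ℕ) (G H : Poly K n)
    (hG : G.IsHomogeneous (2 * j + 1)) (hH : H.IsHomogeneous (2 * j + 1)) : B G H = 0 := by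
  induction j generalizing G H with
  | zero =>
    obtain ⟨G, hG', rfl⟩ := exists_eq_sum_X_mul hG
    obtain ⟨H, hH', rfl⟩ := exists_eq_sum_X_mul hH
    simp only [map_sum, LinearMap.sum_apply]
    refine Finset.sum_eq_zero fun s _ => Finset.sum_eq_zero fun t _ => ?_
    rw [totalDegree_eq_zero_iff_eq_C.1 ((totalDegree_zero_iff_isHomogeneous _).2 (hG' t)),
      totalDegree_eq_zero_iff_eq_C.1 ((totalDegree_zero_iff_isHomogeneous _).2 (hH' s)),
      mul_comm, mul_comm (X s), C_mul', C_mul', map_smul, map_smul, LinearMap.smul_apply, h1,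
      smul_zero, smul_zero]
  | succ j ih =>
    have hd : Odd (2 * j + 1) := odd_two_mul_add_one j
    have hsq := fun s {N H : Poly K n} => X_mul_X_self_mul_eq_zero hB hd ih s (N := N) (H := H)
    have hHd : H.IsHomogeneous (2 * j + 1 + 2) := hH
    have hH1 := mem_parity hHd
    rw [ZMod.natCast_eq_one_iff_odd.2 (hd.add_even even_two)] at hH1
    obtain ⟨E, hE, rfl⟩ := exists_eq_sum_X_mul hG
    rw [map_sum, LinearMap.sum_apply]
    refine Finset.sum_eq_zero fun t _ => ?_
    obtain ⟨N, hN, hEN⟩ := exists_eq_sum_X_mul (hE t)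
    rw [hEN, Finset.mul_sum, map_sum, LinearMap.sum_apply]
    refine Finset.sum_eq_zero fun s _ => ?_
    have hN' : (N s).IsHomogeneous (2 * j + 1) := hN s
    have hN1 := mem_parity hN'
    rw [ZMod.natCast_eq_one_iff_odd.2 hd] at hN1
    -- `xᵤ` is the variable conjugate to `xₛ`, so that `{xᵤ, xₛ² N}` contains `± 2 xₛ N`.
    obtain ⟨c, u, hc, -⟩ := exists_pd_eq_ham (K := K) s
    have h := X_mul_ham_odd_odd hB u t (X_mul_mem_odd (X_mul_mem_even hN1 s) s) hH1
    rw [hsq s hN' (isHomogeneous_X_mul (isHomogeneous_ham hHd t) u), ham_X_mul, ham_X_mul] at h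
    have e : X t * (symp K u s • (X s * N s) + X s * (symp K u s • N s + X s * ham K n u (N s))) =
        (2 * symp K u s) • (X t * (X s * N s)) + X s * (X s * (X t * ham K n u (N s))) := by
      simp only [smul_eq_C_mul, map_mul, map_ofNat]; ring
    rw [e, map_add, LinearMap.add_apply,
      hsq s (isHomogeneous_X_mul (isHomogeneous_ham hN' u) t) hHd, map_smul,
      LinearMap.smul_apply, smul_eq_mul, add_zero, neg_zero] at h
    have h2 : (2 : K) * symp K u s ≠ 0 :=
      mul_ne_zero two_ne_zero (right_ne_zero_of_mul_eq_one hc)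
    exact (mul_eq_zero.1 h).resolve_left h2

/-- An invariant form that vanishes on the span of the variables vanishes in positive degrees. -/
theorem eq_zero_of_isAdInvariant (h1 : ∀ s t, B (X s) (X t) = 0) {a b : ℕ} {G H : Poly K n}
    (hG : G.IsHomogeneous (a + 1)) (hH : H.IsHomogeneous (b + 1)) : B G H = 0 := by
  have hodd : ∀ {a b : ℕ} {G H : Poly K n}, Odd a → Odd b → G.IsHomogeneous a →
      H.IsHomogeneous b → B G H = 0 := by
    intro a b G H ha hb hG hH
    rcases eq_or_ne a b with rfl | hab
    · obtain ⟨j, rfl⟩ := ha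
      exact odd_odd_eq_zero hB h1 j G H hG hH
    · have hG1 := mem_parity hG
      have hH1 := mem_parity hH
      rw [ZMod.natCast_eq_one_iff_odd.2 ha] at hG1
      rw [ZMod.natCast_eq_one_iff_odd.2 hb] at hH1
      exact odd_odd_eq_zero_of_ne hB hab hG1 hH1 hG hH
  have hG1 := mem_parity hG
  have hH1 := mem_parity hH
  rcases Nat.even_or_odd (a + 1) with ha | ha <;> rcases Nat.even_or_odd (b + 1) with hb | hb
  · rw [ZMod.natCast_eq_zero_iff_even.2 hb] at hH1
    rw [Nat.even_add_one, Nat.not_even_iff_odd] at ha hb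
    obtain ⟨E, hE, rfl⟩ := exists_eq_sum_X_mul hG
    rw [map_sum, LinearMap.sum_apply]
    refine Finset.sum_eq_zero fun s _ => ?_
    have hEs := mem_parity (hE s)
    rw [ZMod.natCast_eq_one_iff_odd.2 ha] at hEs
    have h := X_mul_odd_even hB s hEs hH1
    rw [hodd ha hb (hE s) (isHomogeneous_ham hH s)] at h
    simpa using h
  · rw [ZMod.natCast_eq_zero_iff_even.2 ha] at hG1
    rw [ZMod.natCast_eq_one_iff_odd.2 hb] at hH1
    exact even_odd_eq_zero hB hG1 hH1 hG hH
  · rw [ZMod.natCast_eq_one_iff_odd.2 ha] at hG1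
    exact odd_even_eq_zero hB hb hG1 hG hH (by omega)
  · exact hodd ha hb hG hH

end Invariant

theorem IsAdInvariant.sub_smul {B B' : LinearMap.BilinForm K (Poly K n)} (hB : IsAdInvariant B)
    (hB' : IsAdInvariant B') (c : K) : IsAdInvariant (B - c • B') := by
  intro f g F hF G hG H
  have h1 := hB f g F hF G hG H
  have h2 := hB' f g F hF G hG H
  simp only [LinearMap.sub_apply, LinearMap.smul_apply, smul_eq_mul]
  linear_combination h1 - c * h2

/-- After subtraction of the right multiple of `κ`, an invariant form vanishes on the span of the
variables, because there it is a multiple of the symplectic form. -/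
theorem exists_eq_mul_kappa [CharZero K] {B : LinearMap.BilinForm K (Poly K n)}
    (hB : IsAdInvariant B) :
    ∃ α : K, ∀ F ∈ derived K n, ∀ G ∈ derived K n, B F G = α * kappa K n F G := by
  suffices h : ∃ α : K, ∀ s t, (B - α • kappa K n) (X s) (X t) = 0 by
    obtain ⟨α, h⟩ := h
    refine ⟨α, fun F hF G hG => ?_⟩
    rw [← ker_Str, LinearMap.mem_ker] at hF hG
    suffices (B - α • kappa K n) F G = 0 by
      simpa [sub_eq_zero] using this
    refine ker_Str_induction (P := fun F => (B - α • kappa K n) F G = 0) (by simp)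
      (fun F F' h h' => by rw [map_add, LinearMap.add_apply, h, h', add_zero])
      (fun a F hF => ?_) hF
    exact ker_Str_induction (P := fun G => (B - α • kappa K n) F G = 0) (by simp)
      (fun F F' h h' => by rw [map_add, h, h', add_zero])
      (fun b G hG => eq_zero_of_isAdInvariant (hB.sub_smul kappa_adInvariant α) h hF hG) hG
  rcases isEmpty_or_nonempty (Fin n) with hn | ⟨⟨i⟩⟩
  · exact ⟨0, fun s => isEmptyElim s⟩
  have hk : kappa K n (X (Sum.inr i)) (X (Sum.inl i)) = -2⁻¹ := by
    have := kappa_X_mul (K := K) (Sum.inr i) 1 (X (Sum.inl i))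
    rw [mul_one, ham_X, ← MvPolynomial.C_1, kappa_C, Str_C] at this
    simpa [symp] using this
  -- The constant is forced by `κ(qᵢ, pᵢ) = -1/2`.
  refine ⟨-2 * B (X (Sum.inr i)) (X (Sum.inl i)), ?_⟩
  have hB' := hB.sub_smul kappa_adInvariant (-2 * B (X (Sum.inr i)) (X (Sum.inl i)))
  set B' := B - (-2 * B (X (Sum.inr i)) (X (Sum.inl i))) • kappa K n with hBdef
  have h0 : B' (X (Sum.inr i)) (X (Sum.inl i)) = 0 := by
    rw [hBdef, LinearMap.sub_apply, LinearMap.sub_apply, LinearMap.smul_apply,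
      LinearMap.smul_apply, hk, smul_eq_mul]
    have h2 : (2 : K) ≠ 0 := two_ne_zero
    field_simp
    ring
  intro t v
  have h := X_mul_ham_odd_odd hB' (Sum.inl i) t (X_mem_parity (Sum.inr i)) (X_mem_parity v)
  rw [ham_X, ham_X, mul_comm, mul_comm (X (Sum.inl i)), C_mul', C_mul', map_smul, map_smul, h0,
    smul_zero, neg_zero] at h
  simpa [symp] using h

end Moyal

end

theorem theorem4p1 (K : Type*) [Field K] [CharZero K] (n : ℕ) :
    -- the polynomials with the Moyal product are the Weyl algebra
    (∃ e : Moyal.WeylAlgebra K n ≃ₗ[K] Moyal.Poly K n,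
      e 1 = 1 ∧ (∀ a b, e (a * b) = Moyal.star K n (e a) (e b)) ∧
        ∀ s, e (Moyal.weylGen K n s) = MvPolynomial.X s) ∧
    -- `Str` is a supertrace: homogeneous, zero on brackets; its kernel is `[W, W]`
    (∀ F ∈ Moyal.parity K n 1, Moyal.Str K n F = 0) ∧
    (∀ F G, Moyal.Str K n (Moyal.bracket K n F G) = 0) ∧
    LinearMap.ker (Moyal.Str K n) = Moyal.derived K n ∧
    -- the form `κ`
    Moyal.IsSupersymmetric (Moyal.kappa K n) ∧
    Moyal.IsAdInvariant (Moyal.kappa K n) ∧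
    (Moyal.kappa K n).Nondegenerate ∧
    (∀ l m : ℕ, l ≠ m → ∀ F ∈ Moyal.homog K n l, ∀ G ∈ Moyal.homog K n m,
      Moyal.kappa K n F G = 0) ∧
    (∀ l : ℕ, ((Moyal.kappa K n).restrict (Moyal.homog K n l)).Nondegenerate) ∧
    -- uniqueness on `[W, W]`
    (∀ κ' : LinearMap.BilinForm K (Moyal.Poly K n), Moyal.IsAdInvariant κ' →
      ∃ α : K, ∀ F ∈ Moyal.derived K n, ∀ G ∈ Moyal.derived K n,
        κ' F G = α * Moyal.kappa K n F G) :=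
  ⟨⟨Moyal.symbolEquiv K n, Moyal.symbol_one, Moyal.symbol_mul, Moyal.symbol_weylGen⟩,
    fun _ => Moyal.Str_odd, Moyal.Str_bracket, Moyal.ker_Str, Moyal.kappa_supersymmetric,
    Moyal.kappa_adInvariant, Moyal.kappa_nondegenerate,
    fun _ _ hlm _ hF _ hG => Moyal.kappa_eq_zero hlm hF hG,
    Moyal.kappa_restrict_nondegenerate, fun _ => Moyal.exists_eq_mul_kappa⟩
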